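/- Let $M$ be a (Hausdorff) smooth manifold modeled on a real Hausdorff locally convex space $E$, where smoothness of a map on an open subset of a locally convex space means that all iterated directional derivatives exist and are jointly continuous in the point and the directions. Let $K : M \times M \to \mathbb{C}$ be a smooth positive definite kernel, i.e. $\sum_{j,k} K(x_j,x_k)\, c_k \overline{c_j} \ge 0$ for all finite sequences $x_j \in M$, $c_j \in \mathbb{C}$. Let $\mathcal{H}_K \subseteq \mathbb{C}^M$ be its reproducing kernel Hilbert space, let $K_m = K(\cdot, m) \in \mathcal{H}_K$, so that $f(m) = \langle f, K_m\rangle$ for $f \in \mathcal{H}_K$ (inner product linear in the first argument), and let $\mathcal{H}_K^0$ be the linear span of the $K_m$, $m \in M$. For a smooth vector field $X$ on $M$ let $\mathcal{L}_X f = df(X)$ be the Lie derivative of functions, and let $\mathcal{L}_X^K$ be the operator in $\mathcal{H}_K$ with the maximal domain $\mathcal{D}_X = \{\varphi \in \mathcal{H}_K : \mathcal{L}_X\varphi \in \mathcal{H}_K\}$ and $\mathcal{L}_X^K \varphi = \mathcal{L}_X \varphi$. Suppose that $X$ is $K$-symmetric, i.e. the Lie derivatives of $K$ along $X$ in the first and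 in the second argument coincide, $\mathcal{L}_X^1 K = \mathcal{L}_X^2 K$ on $M \times M$, and that for every $m \in M$ there are $\varepsilon_m > 0$ and an integral curve $\gamma_m : [0,\varepsilon_m] \to M$ of $X$ with $\gamma_m(0) = m$. Then: 1. $\mathcal{H}_K^0 \subseteq \mathcal{D}_X$, and $\mathcal{L}_X|_{\mathcal{H}_K^0} : \mathcal{H}_K^0 \to \mathcal{H}_K$ is an essentially selfadjoint operator, i.e. it is densely defined and symmetric and its closure is selfadjoint. 2. The closure of $\mathcal{L}_X|_{\mathcal{H}_K^0}$ is $\mathcal{L}_X^K$. 3. For every $m \in M$, every $\varepsilon_m > 0$, every integral curve $\gamma_m : [0,\varepsilon_m] \to M$ of $X$ with $\gamma_m(0) = m$, and every $0 \le t \le \varepsilon_m$, the vector $K_m$ lies in the domain of $e^{t\mathcal{L}_X^K}$ and $$e^{t \mathcal{L}_X^K} K_m = K_{\gamma_m(t)}.$$ Here $e^{tA} = \int_{\mathbb{R}} e^{t\lambda}\, dP(\lambda)$, with domain $\{v : \int_{\mathbb{R}} e^{2t\lambda}\, d\langle P(\lambda)v, v\rangle < \infty\}$, for a selfadjoint operator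 $A = \int_{\mathbb{R}} \lambda\, dP(\lambda)$ with spectral measure $P$. -/

import Mathlib

open Set Filter Topology MeasureTheory
open scoped ComplexOrder Manifold

/-! ## Differential calculus in locally convex spaces -/

section Calculus

variable {E F : Type*} [AddCommGroup E] [Module ℝ E]
  [AddCommGroup F] [Module ℝ F] [TopologicalSpace F]

/-- `f` has directional derivative `f'` at `x` in the direction `v`:
`f' = lim_{t → 0} (f (x + t v) - f x) / t`. -/
def HasDirDeriv (f : E → F) (f' : F) (x v : E) : Prop :=
  Tendsto (fun t : ℝ => t⁻¹ • (f (x + t • v) - f x)) (𝓝[≠] 0) (𝓝 f')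

variable [TopologicalSpace E]

/-- Smoothness of `f` on an open set `U` of a locally convex space: all iterated directional
derivatives `D k x (h₁, …, hₖ)` of `f` exist at all points of `U`, and each of them is continuous
on `U × E ^ k`. -/
def LCSmoothOn (f : E → F) (U : Set E) : Prop :=
  ∃ D : (k : ℕ) → E → (Fin k → E) → F,
    (∀ x ∈ U, ∀ v, D 0 x v = f x) ∧
    (∀ k, ∀ x ∈ U, ∀ (v : Fin k → E) (h : E),
      HasDirDeriv (fun y => D k y v) (D (k + 1) x (Matrix.vecCons h v)) x h) ∧
    (∀ k, ContinuousOn (fun p : E × (Fin k → E) => D k p.1 p.2) (U ×ˢ univ))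

end Calculus

section ScalarCalculus

variable {E : Type*} [AddCommGroup E] [Module ℝ E]

theorem HasDirDeriv.unique {f : E → ℂ} {a b : ℂ} {x v : E} (ha : HasDirDeriv f a x v)
    (hb : HasDirDeriv f b x v) : a = b :=
  tendsto_nhds_unique ha hb

theorem HasDirDeriv.add' {f g : E → ℂ} {a b : ℂ} {x v : E} (ha : HasDirDeriv f a x v)
    (hb : HasDirDeriv g b x v) : HasDirDeriv (f + g) (a + b) x v := by
  refine (Filter.Tendsto.add ha hb).congr fun t => ?_
  simp only [Pi.add_apply, Complex.real_smul]
  ring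

theorem HasDirDeriv.const_mul' {f : E → ℂ} {a : ℂ} {x v : E} (c : ℂ) (ha : HasDirDeriv f a x v) :
    HasDirDeriv (c • f) (c * a) x v := by
  refine (Filter.Tendsto.const_mul c ha).congr fun t => ?_
  simp only [Pi.smul_apply, Complex.real_smul, smul_eq_mul]
  ring

theorem hasDirDeriv_zero' (x v : E) : HasDirDeriv (0 : E → ℂ) 0 x v := by
  refine tendsto_const_nhds.congr fun t => ?_
  simp

end ScalarCalculus

/-! ## Locally convex manifolds, vector fields, integral curves -/

/-- The charts of the atlas of `M`, with values in the locally convex space `E`,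
have smooth transition maps. -/
class IsLCManifold (E M : Type*) [AddCommGroup E] [Module ℝ E] [TopologicalSpace E]
    [TopologicalSpace M] [ChartedSpace E M] : Prop where
  smooth_transition : ∀ e ∈ atlas E M, ∀ e' ∈ atlas E M,
    LCSmoothOn (e.symm ≫ₕ e') (e.symm ≫ₕ e').source

/-- A smooth vector field on `M`, given by its local representatives in the charts of the atlas,
which transform under a change of charts by the derivative of the transition map. -/
structure LCVectorField (E M : Type*) [AddCommGroup E] [Module ℝ E] [TopologicalSpace E]
    [TopologicalSpace M] [ChartedSpace E M] where
  /-- The local representative in the chart `e`, relevant on `e.target` for `e` in the atlas. -/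
  rep : OpenPartialHomeomorph M E → E → E
  smooth_rep : ∀ e ∈ atlas E M, LCSmoothOn (rep e) e.target
  rep_transition : ∀ e ∈ atlas E M, ∀ e' ∈ atlas E M, ∀ x ∈ (e.symm ≫ₕ e').source,
    HasDirDeriv (e.symm ≫ₕ e') (rep e' ((e.symm ≫ₕ e') x)) x (rep e x)

section Manifold

variable {E M : Type*} [AddCommGroup E] [Module ℝ E] [TopologicalSpace E]
  [TopologicalSpace M] [ChartedSpace E M]

namespace LCVectorField

variable (X : LCVectorField E M)

/-- The value `X(m)`, as a vector of `E` in the preferred chart at `m`. -/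
def valueAt (m : M) : E := X.rep (chartAt E m) (chartAt E m m)

/-- The function `f` on `M` has at `m` the derivative `a` in the direction `X(m)`,
i.e. `(L_X f)(m) = a`. For smooth `f` this does not depend on the chart used. -/
def HasLieDerivAt (f : M → ℂ) (a : ℂ) (m : M) : Prop :=
  HasDirDeriv (f ∘ (chartAt E m).symm) a (chartAt E m m) (X.valueAt m)

/-- `γ : [0, ε] → M` is an integral curve of `X`: it is continuous, and `γ'(t) = X(γ(t))` for all
`t ∈ [0, ε]` (with one-sided derivatives at the two end points), the derivative being computed in
the preferred chart at `γ(t)`. -/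
def IsIntegralCurve (γ : ℝ → M) (ε : ℝ) : Prop :=
  ContinuousOn γ (Icc 0 ε) ∧
  ∀ t ∈ Icc 0 ε,
    Tendsto (fun s : ℝ => (s - t)⁻¹ • (chartAt E (γ t) (γ s) - chartAt E (γ t) (γ t)))
      (𝓝[Icc 0 ε \ {t}] t) (𝓝 (X.valueAt (γ t)))

/-- `X` is `K`-symmetric: `L_X^1 K = L_X^2 K`, the Lie derivatives of the kernel `K` along `X`
in its first and in its second argument. -/
def IsKernelSymmetric (K : M → M → ℂ) : Prop :=
  ∀ m n : M, ∃ a : ℂ, X.HasLieDerivAt (fun x => K x n) a m ∧ X.HasLieDerivAt (fun y => K m y) a n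

end LCVectorField

variable (E) in
/-- Smoothness of `K : M × M → ℂ`, in the product charts of `M × M`. -/
def IsSmoothKernel (K : M → M → ℂ) : Prop :=
  ∀ e ∈ atlas E M, ∀ e' ∈ atlas E M,
    LCSmoothOn (fun p : E × E => K (e.symm p.1) (e'.symm p.2)) (e.target ×ˢ e'.target)

end Manifold

/-! ## Positive definite kernels and their reproducing kernel Hilbert spaces -/

section Kernel

variable {M : Type*}

/-- Positive definite kernels: `∑_{j,k} K(x_j, x_k) c_k \bar{c_j} ≥ 0` for all finite sequences
(in particular, the sum is real). -/
def IsPosDefKernel (K : M → M → ℂ) : Prop :=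
  ∀ (n : ℕ) (x : Fin n → M) (c : Fin n → ℂ),
    0 ≤ ∑ j, ∑ k, K (x j) (x k) * c k * star (c j)

/-- The kernel `K` as an operator-valued kernel. -/
noncomputable def kernelMatrix (K : M → M → ℂ) : Matrix M M (ℂ →L[ℂ] ℂ) :=
  Matrix.of fun x y => K x y • ContinuousLinearMap.id ℂ ℂ

theorem IsPosDefKernel.conj_symm {K : M → M → ℂ} (hK : IsPosDefKernel K) (x y : M) :
    star (K y x) = K x y := by
  have hx := hK 1 ![x] ![1]
  have hy := hK 1 ![y] ![1]
  have h1 := hK 2 ![x, y] ![1, 1]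
  have h2 := hK 2 ![x, y] ![1, Complex.I]
  simp [Fin.sum_univ_two] at hx hy h1 h2
  rw [Complex.le_def] at hx hy h1 h2
  simp at hx hy h1 h2
  apply Complex.ext
  · simp; linarith [h2.2]
  · simp; linarith [h1.2]

theorem IsPosDefKernel.posSemidef {K : M → M → ℂ} (hK : IsPosDefKernel K) :
    (kernelMatrix K).PosSemidef := by
  have htfae := (RKHS.posSemidef_tfae (K := kernelMatrix K)).out 0 2
  refine htfae.mpr ⟨?_, fun c => ?_⟩
  · ext x y
    have := hK.conj_symm x y
    have h1 : star (ContinuousLinearMap.id ℂ ℂ) = ContinuousLinearMap.id ℂ ℂ := star_one _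
    simp only [kernelMatrix, Matrix.conjTranspose_apply, Matrix.of_apply, star_smul, h1, this]
  · have h := hK (c.support.card) (fun j => (c.support.equivFin.symm j : M))
      (fun j => c (c.support.equivFin.symm j))
    have h' := (Complex.le_def.mp h).1
    rw [Complex.zero_re] at h'
    refine h'.trans_eq ((Complex.conj_re _).symm.trans (congrArg Complex.re ?_))
    simp only [Finsupp.sum, kernelMatrix, Matrix.of_apply, map_sum]
    rw [Finset.sum_comm, ← Finset.sum_coe_sort c.support]
    rw [← Equiv.sum_comp c.support.equivFin.symm]
    refine Finset.sum_congr rfl fun k _ => ?_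
    rw [← Finset.sum_coe_sort c.support, ← Equiv.sum_comp c.support.equivFin.symm]
    refine Finset.sum_congr rfl fun j _ => ?_
    simp
    ring

/-- The reproducing kernel Hilbert space `H_K` of the positive definite kernel `K`. Its elements
are functions on `M` through the coercion of `RKHS`. -/
noncomputable abbrev HK (K : M → M → ℂ) [hK : Fact (IsPosDefKernel K)] : Type _ :=
  haveI : Fact (kernelMatrix K).PosSemidef := ⟨hK.out.posSemidef⟩
  RKHS.OfKernel (kernelMatrix K)

variable (K : M → M → ℂ) [hK : Fact (IsPosDefKernel K)]

/-- The element `K_m = K(·, m)` of `H_K`. -/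
noncomputable def kerVec (m : M) : HK K := RKHS.kerFun (HK K) m 1

theorem kerVec_apply (m x : M) : kerVec K m x = K x m := by
  have : Fact (kernelMatrix K).PosSemidef := ⟨hK.out.posSemidef⟩
  rw [kerVec, RKHS.kerFun_apply, RKHS.OfKernel.kernel_ofKernel]
  simp [kernelMatrix]

/-- The subspace `H_K^0` of `H_K` spanned by the elements `K_m`. -/
noncomputable def HK0 : Submodule ℂ (HK K) := Submodule.span ℂ (Set.range (kerVec K))

variable {E : Type*} [AddCommGroup E] [Module ℝ E] [TopologicalSpace E]
  [TopologicalSpace M] [ChartedSpace E M]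

/-- The graph of `L_X^K`: all `(φ, ψ)` in `H_K × H_K` with `L_X φ = ψ`. -/
noncomputable def lieGraph (X : LCVectorField E M) : Submodule ℂ (HK K × HK K) where
  carrier := {p | ∀ m, X.HasLieDerivAt p.1 (p.2 m) m}
  zero_mem' m := by
    simpa [LCVectorField.HasLieDerivAt] using hasDirDeriv_zero' _ _
  add_mem' {p q} hp hq m := by
    have := (hp m).add' (hq m)
    rw [Prod.snd_add, Prod.fst_add, RKHS.coe_add, RKHS.coe_add]
    exact this
  smul_mem' c p hp m := by
    have := (hp m).const_mul' c
    rw [Prod.smul_snd, Prod.smul_fst, RKHS.coe_smul, RKHS.coe_smul]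
    exact this

/-- The operator `L_X^K` with its maximal domain
`D_X = {φ ∈ H_K | L_X φ ∈ H_K}`, on which it is given by `φ ↦ L_X φ`. (All elements of `H_K` are
smooth functions on `M` if `K` is smooth, so the existence of `L_X φ` is no restriction on `φ`.) -/
noncomputable def lieOp (X : LCVectorField E M) : HK K →ₗ.[ℂ] HK K :=
  (lieGraph K X).toLinearPMap

theorem mem_lieGraph_lieOp (X : LCVectorField E M) : (lieOp K X).graph = lieGraph K X := by
  refine Submodule.toLinearPMap_graph_eq _ fun p hp h0 => ?_
  refine RKHS.ext fun m => ?_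
  have h := hp m
  rw [h0] at h
  refine HasDirDeriv.unique h ?_
  simpa using hasDirDeriv_zero' _ _

/-- The domain of `L_X^K` is `D_X`. -/
theorem mem_lieOp_domain_iff (X : LCVectorField E M) (φ : HK K) :
    φ ∈ (lieOp K X).domain ↔ ∃ ψ : HK K, ∀ m, X.HasLieDerivAt φ (ψ m) m := by
  rw [LinearPMap.mem_domain_iff, mem_lieGraph_lieOp]
  rfl

end Kernel

/-! ## Unbounded selfadjoint operators and their spectral calculus -/

section Spectral

open scoped InnerProductSpace

variable {H : Type*} [NormedAddCommGroup H] [InnerProductSpace ℂ H] [CompleteSpace H]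

/-- A densely defined symmetric operator is essentially selfadjoint if its closure is
selfadjoint. -/
structure IsEssentiallySelfAdjoint (A : H →ₗ.[ℂ] H) : Prop where
  dense_domain : Dense (A.domain : Set H)
  symmetric : A.IsFormalAdjoint A
  isSelfAdjoint_closure : IsSelfAdjoint A.closure

variable (H) in
/-- Spectral measures on `ℝ`: projection-valued measures on the Borel sets of `ℝ`, countably
additive in the strong operator topology. -/
structure SpectralMeasure where
  proj : Set ℝ → H →L[ℂ] H
  isStarProjection : ∀ S, MeasurableSet S → IsStarProjection (proj S)
  proj_univ : proj univ = 1
  proj_inter : ∀ S T, MeasurableSet S → MeasurableSet T → proj (S ∩ T) = proj S * proj T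
  hasSum_proj : ∀ S : ℕ → Set ℝ, (∀ n, MeasurableSet (S n)) → Pairwise (Function.onFun Disjoint S) →
    ∀ v, HasSum (fun n => proj (S n) v) (proj (⋃ n, S n) v)

namespace SpectralMeasure

variable (P : SpectralMeasure H)

theorem proj_empty : P.proj ∅ = 0 := by
  ext v
  have h := P.hasSum_proj (fun _ => ∅) (fun _ => MeasurableSet.empty)
    (fun _ _ _ => disjoint_bot_left) v
  have h2 : Tendsto (fun _ : ℕ => P.proj ∅ v) atTop (𝓝 0) :=
    Nat.cofinite_eq_atTop ▸ h.summable.tendsto_cofinite_zero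
  exact tendsto_nhds_unique tendsto_const_nhds h2

theorem re_inner_proj_nonneg {S : Set ℝ} (hS : MeasurableSet S) (v : H) :
    0 ≤ (⟪v, P.proj S v⟫_ℂ).re := by
  have h := P.isStarProjection S hS
  have h2 : P.proj S v = P.proj S (P.proj S v) :=
    (DFunLike.congr_fun h.isIdempotentElem.eq v).symm
  have h3 : ⟪P.proj S v, P.proj S v⟫_ℂ = ⟪v, P.proj S (P.proj S v)⟫_ℂ :=
    h.isSelfAdjoint.isSymmetric v (P.proj S v)
  rw [h2, ← h3]
  exact inner_self_nonneg (𝕜 := ℂ)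

/-- The measure `P^v = ⟨v, P(·) v⟩` on `ℝ`. -/
noncomputable def diag (v : H) : Measure ℝ :=
  Measure.ofMeasurable (fun S _ => ENNReal.ofReal (⟪v, P.proj S v⟫_ℂ).re)
    (by simp [P.proj_empty])
    (by
      intro S hS hd
      have h := (P.hasSum_proj S hS hd v).mapL (innerSL ℂ v)
      have h' := Complex.hasSum_re h
      simp only [innerSL_apply_apply] at h'
      rw [← h'.tsum_eq]
      exact ENNReal.ofReal_tsum_of_nonneg (fun n => P.re_inner_proj_nonneg (hS n) v) h'.summable)

/-- The sesquilinear form `∫ f(λ) d⟨u, P(λ) v⟩`, obtained from the measures `P^v` by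
polarization. -/
noncomputable def sesqIntegral (f : ℝ → ℝ) (u v : H) : ℂ :=
  ((∫ s, f s ∂(P.diag (u + v)) : ℝ) - (∫ s, f s ∂(P.diag (u - v)) : ℝ)
    - Complex.I * (∫ s, f s ∂(P.diag (u + Complex.I • v)) : ℝ)
    + Complex.I * (∫ s, f s ∂(P.diag (u - Complex.I • v)) : ℝ)) / 4

/-- The domain `{v | ∫ |f|² dP^v < ∞}` of the operator `∫ f dP`. -/
def dom (f : ℝ → ℝ) : Set H := {v | ∫⁻ s, ENNReal.ofReal (f s ^ 2) ∂(P.diag v) < ⊤}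

/-- `v` is in the domain of `∫ f dP`, and `(∫ f dP) v = w`. -/
def Maps (f : ℝ → ℝ) (v w : H) : Prop :=
  v ∈ P.dom f ∧ ∀ u ∈ P.dom f, ⟪u, w⟫_ℂ = P.sesqIntegral f u v

/-- `P` is the spectral measure of `A`: one has `A = ∫ λ dP(λ)`, domains included. -/
def IsSpectralMeasureOf (A : H →ₗ.[ℂ] H) : Prop :=
  ∀ v w : H, (v, w) ∈ A.graph ↔ P.Maps (fun s => s) v w

end SpectralMeasure

/-- For a selfadjoint operator `A`: the vector `v` is in the domain of `e^{tA} = ∫ e^{tλ} dP(λ)`,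
and `e^{tA} v = w`, where `P` is the (unique) spectral measure of `A`. -/
def ExpMaps (A : H →ₗ.[ℂ] H) (t : ℝ) (v w : H) : Prop :=
  ∃ P : SpectralMeasure H, P.IsSpectralMeasureOf A ∧ P.Maps (fun s => Real.exp (t * s)) v w

end Spectral

/-! Smoothness of K makes m ↦ K_m differentiable in H_K: inner products of difference quotients of
K_m are mixed second difference quotients of K, and these converge (`exists_hasKerVecDeriv`). Let
Y_m be the derivative at m in the direction X(m). The reproducing property gives (L_X f)(m) = ⟪Y_m,
f⟫, so the graph of the maximal operator L_X^K is the adjoint of the relation G spanned by the pairs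
(K_m, Y_m) (`mem_lieGraph_iff`). K-symmetry says that L_X K_m = Y_m; hence G is symmetric and is the
graph of L_X on H_K^0. Apart from the exponential formula, everything reduces to showing that the
closure of G is G*.

This is Fröhlich's criterion (`Submodule.topologicalClosure_eq_adjoint_of_curves`). Along an
integral curve, φ(t) = K_{γ(t)} solves φ' = Aφ. A deficiency vector w, with (w, cw) in G* and c =
±i, satisfies ⟪w, φ(t)⟫ = e^{c̄t}⟪w, φ(0)⟫. For selfadjoint A, however, e^{zA}φ(0) is holomorphic on
the strip 0 < Re z < ε and bounded there in terms of φ(0) and φ(ε), while e^{c̄z} is unbounded on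
vertical lines; so w is orthogonal to every K_m and vanishes. Since G is not known beforehand to
have a selfadjoint extension in H, the argument is run for the diagonal curve (φ, φ) and the
selfadjoint relation [[0, G**], [G*, 0]] on H ⊕ H.

Spectral measures serve both the strip argument and the definition of e^{tA}. They come from the
normal resolvent (A + i)⁻¹: Riesz–Markov turns its continuous functional calculus into measures,
bounded pointwise limits extend the calculus to Borel functions, and z ↦ Re(1/z) carries it from the
spectrum to ℝ. Unbounded functions are handled through truncation to [-n, n]: (∫ f dP) v = w means
1_n w = (1_n f) v for all n (`maps_iff`). In this form e^{tA} φ(0) = φ(t) holds because the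
truncated e^{-tA} φ(t) has derivative zero (`cutoff_apply_curve`). -/

/-! ## Bounded measurable functions -/

/-- Bounded measurable complex functions. -/
def BddMeas {X : Type*} [MeasurableSpace X] (f : X → ℂ) : Prop :=
  Measurable f ∧ ∃ C : ℝ, ∀ x, ‖f x‖ ≤ C

namespace BddMeas

section Basic

variable {X : Type*} [MeasurableSpace X] {f g : X → ℂ}

theorem add (hf : BddMeas f) (hg : BddMeas g) : BddMeas (f + g) := by
  obtain ⟨C, hC⟩ := hf.2
  obtain ⟨D, hD⟩ := hg.2
  exact ⟨hf.1.add hg.1, C + D, fun x => (norm_add_le _ _).trans (add_le_add (hC x) (hD x))⟩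

theorem const_smul (c : ℂ) (hf : BddMeas f) : BddMeas (c • f) := by
  obtain ⟨C, hC⟩ := hf.2
  refine ⟨hf.1.const_smul c, ‖c‖ * C, fun x => ?_⟩
  rw [Pi.smul_apply, norm_smul]
  exact mul_le_mul_of_nonneg_left (hC x) (norm_nonneg _)

theorem mul (hf : BddMeas f) (hg : BddMeas g) : BddMeas (f * g) := by
  obtain ⟨C, hC⟩ := hf.2
  obtain ⟨D, hD⟩ := hg.2
  refine ⟨hf.1.mul hg.1, C * D, fun x => ?_⟩
  rw [Pi.mul_apply, norm_mul]
  exact mul_le_mul (hC x) (hD x) (norm_nonneg _) ((norm_nonneg _).trans (hC x))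

theorem star (hf : BddMeas f) : BddMeas (star f) := by
  obtain ⟨C, hC⟩ := hf.2
  exact ⟨Complex.continuous_conj.measurable.comp hf.1, C, fun x => by simpa using hC x⟩

theorem indicator_one {S : Set X} (hS : MeasurableSet S) : BddMeas (S.indicator (1 : X → ℂ)) :=
  ⟨measurable_one.indicator hS, 1, fun x => by
    refine (norm_indicator_le_norm_self _ _).trans (by simp)⟩

theorem comp {Y : Type*} [MeasurableSpace Y] {g : Y → X} (hf : BddMeas f) (hg : Measurable g) :
    BddMeas (f ∘ g) :=
  ⟨hf.1.comp hg, hf.2.imp fun _ h y => h (g y)⟩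

theorem integrable (hf : BddMeas f) (μ : Measure X) [IsFiniteMeasure μ] : Integrable f μ := by
  obtain ⟨C, hC⟩ := hf.2
  exact Integrable.of_bound hf.1.aestronglyMeasurable C (.of_forall hC)

end Basic

/-- A property of bounded measurable functions on a metrizable space which holds for bounded
continuous functions and is stable under linear combinations and bounded pointwise limits holds for
all bounded measurable functions. -/
theorem induction {X : Type*} [TopologicalSpace X] [HasOuterApproxClosed X] [MeasurableSpace X]
    [BorelSpace X] {p : (X → ℂ) → Prop}
    (hcont : ∀ f : X → ℂ, Continuous f → BddMeas f → p f)
    (hadd : ∀ f g, BddMeas f → BddMeas g → p f → p g → p (f + g))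
    (hsmul : ∀ (c : ℂ) (f), BddMeas f → p f → p (c • f))
    (hlim : ∀ (F : ℕ → X → ℂ) (f : X → ℂ) (C : ℝ), (∀ n, Measurable (F n)) →
      (∀ n x, ‖F n x‖ ≤ C) → (∀ x, Tendsto (fun n => F n x) atTop (𝓝 (f x))) →
      (∀ n, p (F n)) → p f) {f : X → ℂ} (hf : BddMeas f) : p f := by
  -- Closed sets form a π-system generating the Borel sets, and their indicators are bounded
  -- pointwise limits of continuous functions.
  have hind : ∀ S : Set X, MeasurableSet S → p (S.indicator 1) := by
    intro S hS
    induction S, hS using MeasurableSpace.induction_on_inter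
      ((BorelSpace.measurable_eq (α := X)).trans borel_eq_generateFrom_isClosed)
      isPiSystem_isClosed with
    | empty =>
      rw [indicator_empty]
      exact hcont 0 continuous_const ⟨measurable_const, 0, by simp⟩
    | basic S hS =>
      have hc : ∀ n, Continuous fun x => ((IsClosed.apprSeq hS n x : ℝ) : ℂ) := fun n =>
        Complex.continuous_ofReal.comp
          (NNReal.continuous_coe.comp (IsClosed.apprSeq hS n).continuous)
      have hb : ∀ n x, ‖((IsClosed.apprSeq hS n x : ℝ) : ℂ)‖ ≤ 1 := fun n x => by
        simpa using HasOuterApproxClosed.apprSeq_apply_le_one hS n x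
      refine hlim (fun n x => ((IsClosed.apprSeq hS n x : ℝ) : ℂ)) _ 1
        (fun n => (hc n).measurable) hb (fun x => ?_)
        fun n => hcont _ (hc n) ⟨(hc n).measurable, 1, hb n⟩
      have h := tendsto_pi_nhds.mp (HasOuterApproxClosed.tendsto_apprSeq hS) x
      have h' := (Complex.continuous_ofReal.comp NNReal.continuous_coe).continuousAt.tendsto.comp h
      have hi : S.indicator (1 : X → ℂ) x =
          (((S.indicator (fun _ => (1 : NNReal)) x : NNReal) : ℝ) : ℂ) := by
        by_cases hx : x ∈ S <;> simp [hx]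
      rw [hi]
      exact h'
    | compl S hS ih =>
      have h := hadd (fun _ => 1) _ ⟨measurable_const, 1, by simp⟩ ((indicator_one hS).const_smul (-1))
        (hcont (fun _ => 1) continuous_const ⟨measurable_const, 1, by simp⟩)
        (hsmul (-1) _ (indicator_one hS) ih)
      convert h using 1
      rw [Set.indicator_compl]
      ext x
      simp [sub_eq_add_neg]
    | iUnion S hd hS ih =>
      have hfin : ∀ n : ℕ, p ((⋃ i ∈ Finset.range n, S i).indicator 1) := by
        intro n
        induction n with
        | zero =>
          simp only [Finset.range_zero, Finset.notMem_empty, iUnion_of_empty, iUnion_empty,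
            indicator_empty]
          exact hcont 0 continuous_const ⟨measurable_const, 0, by simp⟩
        | succ n ihn =>
          have h := hadd _ _ (indicator_one (.biUnion (to_countable _) fun i _ => hS i))
            (indicator_one (hS n)) ihn (ih n)
          convert h using 1
          rw [Finset.range_add_one, Finset.set_biUnion_insert, union_comm,
            indicator_union_of_disjoint]
          · rfl
          · simp only [Finset.mem_range, disjoint_iUnion_left]
            exact fun i hi => hd hi.ne
      refine hlim (fun n => (⋃ i ∈ Finset.range n, S i).indicator 1) _ 1
        (fun n => (indicator_one (.biUnion (to_countable _) fun i _ => hS i)).1)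
        (fun n x => (norm_indicator_le_norm_self _ _).trans (by simp)) (fun x => ?_) hfin
      refine tendsto_const_nhds.congr' ?_
      by_cases hx : x ∈ ⋃ i, S i
      · obtain ⟨i, hi⟩ := mem_iUnion.mp hx
        filter_upwards [eventually_gt_atTop i] with n hn
        rw [indicator_of_mem hx, indicator_of_mem]
        exact mem_biUnion (Finset.mem_coe.mpr (Finset.mem_range.mpr hn)) hi
      · refine .of_forall fun n => ?_
        dsimp only
        rw [indicator_of_notMem hx, indicator_of_notMem]
        exact fun h => hx (iUnion₂_subset_iUnion _ _ h)
  have hsimple : ∀ f : SimpleFunc X ℂ, p f := by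
    intro f
    have hbdd : ∀ f : SimpleFunc X ℂ, BddMeas f := fun f =>
      ⟨f.measurable, f.exists_forall_norm_le⟩
    induction f using SimpleFunc.induction with
    | @const c s hs =>
      convert hsmul c _ (indicator_one hs) (hind _ hs) using 1
      ext x
      by_cases hx : x ∈ s <;> simp [Set.piecewise, hx]
    | add _ ihf ihg => exact hadd _ _ (hbdd _) (hbdd _) ihf ihg
  obtain ⟨C, hC⟩ := hf.2
  have hsm := hf.1.stronglyMeasurable
  -- The bound for `approxBounded` has to be nonnegative; `C` may be negative if `X` is empty.
  exact hlim (fun n => hsm.approxBounded (max C 0) n) f (max C 0)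
    (fun n => (hsm.approxBounded (max C 0) n).measurable)
    (fun n x => hsm.norm_approxBounded_le (le_max_right _ _) n x)
    (fun x => hsm.tendsto_approxBounded_of_norm_le ((hC x).trans (le_max_left _ _)))
    (fun n => hsimple _)

end BddMeas

/-! ## Operators represented by a family of measures -/

section Represents

open scoped InnerProductSpace

variable {H : Type*} [NormedAddCommGroup H] [InnerProductSpace ℂ H]
  {X : Type*} [MeasurableSpace X]

/-- The operator `Q` has the quadratic form `v ↦ ∫ f dμ_v`. -/
def Represents (μ : H → Measure X) (f : X → ℂ) (Q : H →L[ℂ] H) : Prop :=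
  ∀ v, ⟪v, Q v⟫_ℂ = ∫ x, f x ∂(μ v)

/-- The arrangement of the four terms is that of `SpectralMeasure.sesqIntegral`, so limits of
quadratic forms can be transferred term by term. -/
theorem inner_polarization (Q : H →L[ℂ] H) (u v : H) :
    ⟪u, Q v⟫_ℂ = (⟪u + v, Q (u + v)⟫_ℂ - ⟪u - v, Q (u - v)⟫_ℂ
      - Complex.I * ⟪u + Complex.I • v, Q (u + Complex.I • v)⟫_ℂ
      + Complex.I * ⟪u - Complex.I • v, Q (u - Complex.I • v)⟫_ℂ) / 4 := by
  simp only [map_add, map_sub, map_smul, inner_add_left, inner_add_right, inner_sub_left,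
    inner_sub_right, inner_smul_left, inner_smul_right, Complex.conj_I]
  linear_combination (1 / 2) * (⟪u, Q v⟫_ℂ - ⟪v, Q u⟫_ℂ) * Complex.I_sq

theorem ContinuousLinearMap.ext_of_inner_self {Q R : H →L[ℂ] H}
    (h : ∀ v, ⟪v, Q v⟫_ℂ = ⟪v, R v⟫_ℂ) : Q = R := by
  ext v
  refine ext_inner_left ℂ fun u => ?_
  rw [inner_polarization Q, inner_polarization R]
  simp only [h]

/-- Polarization and the parallelogram law bound |⟪u, Qv⟫| by C(‖u‖² + ‖v‖²). The factor 2 reflects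
that Q need not be selfadjoint. -/
theorem ContinuousLinearMap.norm_le_of_inner_self_le {Q : H →L[ℂ] H} {C : ℝ} (hC : 0 ≤ C)
    (h : ∀ v, ‖⟪v, Q v⟫_ℂ‖ ≤ C * ‖v‖ ^ 2) : ‖Q‖ ≤ 2 * C := by
  have key : ∀ u v : H, ‖⟪u, Q v⟫_ℂ‖ ≤ C * (‖u‖ ^ 2 + ‖v‖ ^ 2) := by
    intro u v
    rw [inner_polarization Q, norm_div]
    have e1 := parallelogram_law_with_norm ℂ u v
    have e2 := parallelogram_law_with_norm ℂ u (Complex.I • v)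
    rw [norm_smul, Complex.norm_I, one_mul] at e2
    have h4 : ‖(4 : ℂ)‖ = 4 := by simp
    rw [h4, div_le_iff₀ (by norm_num)]
    refine (norm_add_le _ _).trans ?_
    refine (add_le_add_left (norm_sub_le _ _) _).trans ?_
    refine (add_le_add_left (add_le_add_left (norm_sub_le _ _) _) _).trans ?_
    rw [norm_mul, norm_mul, Complex.norm_I, one_mul, one_mul]
    have := h (u + v)
    have := h (u - v)
    have := h (u + Complex.I • v)
    have := h (u - Complex.I • v)
    nlinarith
  refine Q.opNorm_le_bound (by positivity) fun v => ?_
  by_cases hQ : ‖Q v‖ = 0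
  · rw [hQ]; positivity
  have hQ' : 0 < ‖Q v‖ := lt_of_le_of_ne (norm_nonneg _) (Ne.symm hQ)
  by_cases hv : ‖v‖ = 0
  · rw [norm_eq_zero] at hv; simp [hv]
  have hv' : 0 < ‖v‖ := lt_of_le_of_ne (norm_nonneg _) (Ne.symm hv)
  -- Taking u parallel to Qv and of norm ‖v‖ gives ‖v‖‖Qv‖ ≤ 2C‖v‖².
  have h1 := key (((‖v‖ / ‖Q v‖ : ℝ) : ℂ) • Q v) v
  rw [inner_smul_left, norm_mul, norm_smul, inner_self_eq_norm_sq_to_K, Complex.conj_ofReal,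
    Complex.norm_real, Real.norm_of_nonneg (by positivity)] at h1
  have h2 : ‖v‖ / ‖Q v‖ * ‖Q v‖ = ‖v‖ := by field_simp
  have h3 : ‖((‖Q v‖ : ℂ)) ^ 2‖ = ‖Q v‖ ^ 2 := by simp
  have h1' : ‖v‖ / ‖Q v‖ * ‖Q v‖ ^ 2 ≤ C * ((‖v‖ / ‖Q v‖ * ‖Q v‖) ^ 2 + ‖v‖ ^ 2) := by
    rw [← h3]; exact h1
  rw [h2, pow_two ‖Q v‖, ← mul_assoc, h2] at h1'
  nlinarith

namespace Represents

variable {μ : H → Measure X} {f g : X → ℂ} {Q R : H →L[ℂ] H}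

theorem unique (hQ : Represents μ f Q) (hR : Represents μ f R) : Q = R :=
  ContinuousLinearMap.ext_of_inner_self fun v => (hQ v).trans (hR v).symm

theorem const_smul (c : ℂ) (hQ : Represents μ f Q) : Represents μ (c • f) (c • Q) := fun v => by
  rw [smul_apply, inner_smul_right, hQ v, ← integral_const_mul]
  rfl

theorem adjoint [CompleteSpace H] (hQ : Represents μ f Q) :
    Represents μ (star f) (ContinuousLinearMap.adjoint Q) := fun v => by
  rw [ContinuousLinearMap.adjoint_inner_right, ← inner_conj_symm, hQ v, ← integral_conj]
  rfl

variable [∀ v, IsFiniteMeasure (μ v)]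

theorem add (hf : BddMeas f) (hg : BddMeas g) (hQ : Represents μ f Q) (hR : Represents μ g R) :
    Represents μ (f + g) (Q + R) := fun v => by
  rw [add_apply, inner_add_right, hQ v, hR v]
  exact (integral_add (hf.integrable _) (hg.integrable _)).symm

theorem norm_le (hμ : ∀ v, (μ v).real univ ≤ ‖v‖ ^ 2) {C : ℝ} (hC : 0 ≤ C) (hf : ∀ x, ‖f x‖ ≤ C)
    (hQ : Represents μ f Q) : ‖Q‖ ≤ 2 * C := by
  refine ContinuousLinearMap.norm_le_of_inner_self_le hC fun v => ?_
  rw [hQ v]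
  exact (norm_integral_le_of_norm_le_const (.of_forall hf)).trans
    (mul_le_mul_of_nonneg_left (hμ v) hC)

/-- Dominated convergence gives limits of the quadratic forms, polarization gives limits of the
sesquilinear forms, and the uniform norm bound makes the limit form bounded, hence given by an
operator. -/
theorem exists_limit [CompleteSpace H] (hμ : ∀ v, (μ v).real univ ≤ ‖v‖ ^ 2) {F : ℕ → X → ℂ}
    {C : ℝ} (hF : ∀ n, Measurable (F n)) (hC : ∀ n x, ‖F n x‖ ≤ C)
    (hlim : ∀ x, Tendsto (fun n => F n x) atTop (𝓝 (f x))) {Q : ℕ → H →L[ℂ] H}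
    (hQ : ∀ n, Represents μ (F n) (Q n)) :
    ∃ R : H →L[ℂ] H, Represents μ f R ∧
      ∀ u v, Tendsto (fun n => ⟪u, Q n v⟫_ℂ) atTop (𝓝 ⟪u, R v⟫_ℂ) := by
  have hself : ∀ v, Tendsto (fun n => ⟪v, Q n v⟫_ℂ) atTop (𝓝 (∫ x, f x ∂(μ v))) := by
    intro v
    simp only [hQ _ v]
    exact tendsto_integral_of_dominated_convergence (fun _ => C)
      (fun n => (hF n).aestronglyMeasurable) (integrable_const C)
      (fun n => .of_forall (hC n)) (.of_forall hlim)
  have hex : ∀ u v, ∃ a, Tendsto (fun n => ⟪u, Q n v⟫_ℂ) atTop (𝓝 a) := by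
    intro u v
    simp only [fun n => inner_polarization (Q n) u v]
    exact ⟨_, ((((hself _).sub (hself _)).sub ((hself _).const_mul _)).add
      ((hself _).const_mul _)).div_const _⟩
  choose B hB using hex
  have hbound : ∀ u v, ‖B u v‖ ≤ 2 * max C 0 * ‖u‖ * ‖v‖ := by
    intro u v
    refine le_of_tendsto (hB u v).norm (.of_forall fun n => ?_)
    have h := norm_le hμ (le_max_right C 0) (fun x => (hC n x).trans (le_max_left _ _)) (hQ n)
    calc ‖⟪u, Q n v⟫_ℂ‖ ≤ ‖u‖ * (‖Q n‖ * ‖v‖) :=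
          (norm_inner_le_norm _ _).trans
            (mul_le_mul_of_nonneg_left ((Q n).le_opNorm v) (norm_nonneg _))
      _ ≤ ‖u‖ * (2 * max C 0 * ‖v‖) := by gcongr
      _ = _ := by ring
  -- B is antilinear in u and linear in v; conjugating and exchanging the arguments gives the form
  -- required by the Riesz representation.
  let L : H →L⋆[ℂ] H →L[ℂ] ℂ := LinearMap.mkContinuous₂
    (LinearMap.mk₂'ₛₗ (starRingEnd ℂ) (RingHom.id ℂ) (fun v u => star (B u v))
      (fun v w u => by
        rw [← star_add]
        congr 1
        refine tendsto_nhds_unique (hB _ _) (((hB u v).add (hB u w)).congr fun n => ?_)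
        rw [map_add, inner_add_right])
      (fun c v u => by
        rw [smul_eq_mul, ← star_star (starRingEnd ℂ c), ← star_mul']
        congr 1
        have h := ((hB u v).const_mul c).congr fun n =>
          show c * ⟪u, Q n v⟫_ℂ = ⟪u, Q n (c • v)⟫_ℂ by rw [map_smul, inner_smul_right]
        simpa using tendsto_nhds_unique (hB _ _) h)
      (fun v u w => by
        rw [← star_add]
        congr 1
        refine tendsto_nhds_unique (hB _ _) (((hB u v).add (hB w v)).congr fun n => ?_)
        rw [inner_add_left])
      (fun c v u => by
        rw [RingHom.id_apply, smul_eq_mul, ← star_star c, ← star_mul']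
        congr 1
        refine tendsto_nhds_unique (hB _ _) (((hB u v).const_mul (star c)).congr fun n => ?_)
        rw [star_star, inner_smul_left]
        rfl)) (2 * max C 0) (fun v u => by
          simpa [mul_assoc, mul_comm ‖u‖ ‖v‖] using hbound u v)
  have hL : ∀ u v, ⟪u, InnerProductSpace.continuousLinearMapOfBilin L v⟫_ℂ = B u v := by
    intro u v
    rw [← inner_conj_symm, InnerProductSpace.continuousLinearMapOfBilin_apply]
    simp [L]
  refine ⟨InnerProductSpace.continuousLinearMapOfBilin L, fun v => ?_, fun u v => ?_⟩
  · rw [hL]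
    exact tendsto_nhds_unique (hB v v) (hself v)
  · rw [hL]
    exact hB u v

/-- If continuous functions are represented by operators, then so are bounded measurable functions.
Compatibility with left multiplication by given represented functions is inherited. -/
theorem exists_of_continuous [CompleteSpace H] [TopologicalSpace X] [HasOuterApproxClosed X]
    [BorelSpace X] (hμ : ∀ v, (μ v).real univ ≤ ‖v‖ ^ 2) (S : Set ((X → ℂ) × (H →L[ℂ] H)))
    (hS : ∀ s ∈ S, BddMeas s.1)
    (hcont : ∀ f : X → ℂ, Continuous f → BddMeas f →
      ∃ Q, Represents μ f Q ∧ ∀ s ∈ S, Represents μ (s.1 * f) (s.2 * Q)) (hf : BddMeas f) :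
    ∃ Q, Represents μ f Q ∧ ∀ s ∈ S, Represents μ (s.1 * f) (s.2 * Q) := by
  refine BddMeas.induction (p := fun f => ∃ Q, Represents μ f Q ∧
    ∀ s ∈ S, Represents μ (s.1 * f) (s.2 * Q)) hcont ?_ ?_ ?_ hf
  · intro f g hf hg ihf ihg
    obtain ⟨Q, hQ, hQS⟩ := ihf
    obtain ⟨R, hR, hRS⟩ := ihg
    refine ⟨Q + R, hQ.add hf hg hR, fun s hs => ?_⟩
    rw [mul_add, mul_add]
    exact (hQS s hs).add ((hS s hs).mul hf) ((hS s hs).mul hg) (hRS s hs)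
  · intro c f hf ih
    obtain ⟨Q, hQ, hQS⟩ := ih
    refine ⟨c • Q, hQ.const_smul c, fun s hs => ?_⟩
    rw [mul_smul_comm, mul_smul_comm]
    exact (hQS s hs).const_smul c
  · intro F f C hF hC hlim ih
    choose Q hQ hQS using ih
    obtain ⟨R, hR, hw⟩ := exists_limit hμ hF hC hlim hQ
    refine ⟨R, hR, fun s hs v => ?_⟩
    obtain ⟨D, hD⟩ := (hS s hs).2
    -- Left multiplication by a fixed operator respects weak limits, since it can be moved to the
    -- other side as an adjoint.
    have h1 : Tendsto (fun n => ⟪v, (s.2 * Q n) v⟫_ℂ) atTop (𝓝 ⟪v, (s.2 * R) v⟫_ℂ) := by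
      have := hw (ContinuousLinearMap.adjoint s.2 v) v
      simp only [ContinuousLinearMap.adjoint_inner_left] at this
      exact this
    refine tendsto_nhds_unique h1 ?_
    simp only [hQS _ s hs v]
    refine tendsto_integral_of_dominated_convergence (fun _ => D * C)
      (fun n => ((hS s hs).1.mul (hF n)).aestronglyMeasurable) (integrable_const _)
      (fun n => .of_forall fun x => ?_)
      (.of_forall fun x => (hlim x).const_mul (s.1 x))
    rw [Pi.mul_apply, norm_mul]
    exact mul_le_mul (hD x) (hC n x) (norm_nonneg _) ((norm_nonneg _).trans (hD x))

end Represents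

end Represents

/-! ## Bounded measurable functional calculus of a representation of `C(X, ℂ)` -/

section StarAlgHom

open scoped InnerProductSpace

variable {H : Type*} [NormedAddCommGroup H] [InnerProductSpace ℂ H] [CompleteSpace H]
  {X : Type*} [TopologicalSpace X]

/-- A real continuous function as a complex continuous function. -/
def ContinuousMap.toComplex (f : C(X, ℝ)) : C(X, ℂ) :=
  ⟨fun x => (f x : ℂ), Complex.continuous_ofReal.comp f.continuous⟩

theorem ContinuousMap.exists_toComplex_eq (f : C(X, ℂ)) :
    ∃ g h : C(X, ℝ), f = g.toComplex + Complex.I • h.toComplex :=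
  ⟨⟨fun x => (f x).re, Complex.continuous_re.comp f.continuous⟩,
    ⟨fun x => (f x).im, Complex.continuous_im.comp f.continuous⟩, by
    ext x
    simp [toComplex, mul_comm Complex.I, Complex.re_add_im]⟩

variable (Φ : C(X, ℂ) →⋆ₐ[ℂ] (H →L[ℂ] H))

theorem StarAlgHom.inner_self_toComplex (f : C(X, ℝ)) (v : H) :
    ⟪v, Φ f.toComplex v⟫_ℂ = ((⟪v, Φ f.toComplex v⟫_ℂ).re : ℂ) := by
  have h : star f.toComplex = f.toComplex := by
    ext x
    simp [ContinuousMap.toComplex]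
  have h2 : ContinuousLinearMap.adjoint (Φ f.toComplex) = Φ f.toComplex := by
    rw [← ContinuousLinearMap.star_eq_adjoint, ← map_star, h]
  rw [eq_comm, ← Complex.conj_eq_iff_re, inner_conj_symm,
    ← ContinuousLinearMap.adjoint_inner_right, h2]

/-- With g = √f one has Φ f = (Φ g)* Φ g. -/
theorem StarAlgHom.re_inner_self_nonneg {f : C(X, ℝ)} (hf : ∀ x, 0 ≤ f x) (v : H) :
    0 ≤ (⟪v, Φ f.toComplex v⟫_ℂ).re := by
  let g : C(X, ℝ) := ⟨fun x => √(f x), f.continuous.sqrt⟩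
  have h : f.toComplex = star g.toComplex * g.toComplex := by
    ext x
    simp only [ContinuousMap.toComplex, ContinuousMap.coe_mk, ContinuousMap.mul_apply,
      ContinuousMap.star_apply, g, RCLike.star_def, Complex.conj_ofReal]
    rw [← Complex.ofReal_mul, Real.mul_self_sqrt (hf x)]
  rw [h, map_mul, map_star, ContinuousLinearMap.star_eq_adjoint, mul_apply_eq_comp,
    ContinuousLinearMap.adjoint_inner_right]
  exact inner_self_nonneg (𝕜 := ℂ)

variable [CompactSpace X] [T2Space X] [MeasurableSpace X] [BorelSpace X]

/-- Riesz–Markov for the positive functional f ↦ ⟪v, Φ f v⟫ on real functions; complex functions are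
split into real and imaginary parts. -/
theorem StarAlgHom.exists_measure (v : H) : ∃ μ : Measure X, IsFiniteMeasure μ ∧
    ∀ f : C(X, ℂ), ⟪v, Φ f v⟫_ℂ = ∫ x, f x ∂μ := by
  let Λ : CompactlySupportedContinuousMap X ℝ →ₚ[ℝ] ℝ :=
    { toFun f := (⟪v, Φ (f : C(X, ℝ)).toComplex v⟫_ℂ).re
      map_add' f g := by
        have : (((f + g : CompactlySupportedContinuousMap X ℝ) : C(X, ℝ))).toComplex
            = (f : C(X, ℝ)).toComplex + (g : C(X, ℝ)).toComplex := by
          ext x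
          simp [ContinuousMap.toComplex]
        rw [this, map_add, add_apply, inner_add_right, Complex.add_re]
      map_smul' c f := by
        have : (((c • f : CompactlySupportedContinuousMap X ℝ) : C(X, ℝ))).toComplex
            = (c : ℂ) • (f : C(X, ℝ)).toComplex := by
          ext x
          simp [ContinuousMap.toComplex]
        rw [this, map_smul, smul_apply, inner_smul_right, Complex.re_ofReal_mul]
        rfl
      monotone' f g hfg := by
        have : (g : C(X, ℝ)).toComplex
            = (f : C(X, ℝ)).toComplex + ((g : C(X, ℝ)) - (f : C(X, ℝ))).toComplex := by
          ext x
          simp [ContinuousMap.toComplex]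
        dsimp only
        rw [this, map_add, add_apply, inner_add_right, Complex.add_re]
        exact le_add_of_nonneg_right
          (StarAlgHom.re_inner_self_nonneg Φ (fun x => sub_nonneg.mpr (hfg x)) v) }
  have hΛ : ∀ f : C(X, ℝ), ⟪v, Φ f.toComplex v⟫_ℂ = ∫ x, f.toComplex x ∂(RealRMK.rieszMeasure Λ) := by
    intro f
    have h := RealRMK.integral_rieszMeasure Λ ⟨f, HasCompactSupport.of_compactSpace _⟩
    refine (StarAlgHom.inner_self_toComplex Φ f v).trans ?_
    refine (congrArg Complex.ofReal h.symm).trans ?_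
    exact integral_ofReal.symm
  have hint : ∀ f : C(X, ℂ), Integrable f (RealRMK.rieszMeasure Λ) := fun f =>
    f.continuous.integrable_of_hasCompactSupport (HasCompactSupport.of_compactSpace _)
  refine ⟨RealRMK.rieszMeasure Λ, inferInstance, fun f => ?_⟩
  obtain ⟨g, h, rfl⟩ := f.exists_toComplex_eq
  rw [map_add, map_smul, add_apply, smul_apply, inner_add_right, inner_smul_right, hΛ, hΛ,
    ← integral_const_mul, ← integral_add (hint _) ((hint _).const_mul _)]
  rfl

variable [HasOuterApproxClosed X]

/-- The bounded measurable functional calculus extending a representation of `C(X, ℂ)`. -/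
theorem StarAlgHom.exists_represents : ∃ (μ : H → Measure X) (op : (X → ℂ) → H →L[ℂ] H),
    (∀ v, IsFiniteMeasure (μ v)) ∧ (∀ f : C(X, ℂ), op f = Φ f) ∧
    (∀ f, BddMeas f → Represents μ f (op f)) ∧
    ∀ f g, BddMeas f → BddMeas g → op (f * g) = op f * op g := by
  choose μ hfin hμ using StarAlgHom.exists_measure Φ
  have hC : ∀ f : C(X, ℂ), Represents μ f (Φ f) := fun f v => hμ v f
  have hnorm : ∀ v, (μ v).real univ ≤ ‖v‖ ^ 2 := by
    intro v
    have h := hμ v 1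
    rw [map_one, one_apply_eq_self, inner_self_eq_norm_sq_to_K] at h
    simp only [ContinuousMap.one_apply, integral_const, Complex.real_smul, mul_one] at h
    refine le_of_eq (Complex.ofReal_injective ?_)
    rw [Complex.ofReal_pow]
    exact h.symm
  have hbdd : ∀ f : C(X, ℂ), BddMeas f := fun f =>
    ⟨f.continuous.measurable, ‖f‖, f.norm_coe_le_norm⟩
  -- Multiplicativity is extended one factor at a time: here the left factor is still continuous and
  -- only the right one is measurable.
  have step1 : ∀ g, BddMeas g → ∃ Q, Represents μ g Q ∧
      ∀ s ∈ range fun f : C(X, ℂ) => ((f : X → ℂ), Φ f), Represents μ (s.1 * g) (s.2 * Q) := by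
    intro g hg
    refine Represents.exists_of_continuous hnorm _ ?_ ?_ hg
    · rintro _ ⟨f, rfl⟩
      exact hbdd f
    · intro g hg _
      refine ⟨Φ ⟨g, hg⟩, hC ⟨g, hg⟩, ?_⟩
      rintro _ ⟨f, rfl⟩
      dsimp only
      rw [← map_mul]
      exact hC (f * ⟨g, hg⟩)
  -- Now both factors are measurable. For a continuous right factor the claim is the adjoint of
  -- `step1`, applied to the conjugate of the left factor.
  have step2 : ∀ f, BddMeas f → ∃ Q, Represents μ f Q ∧
      ∀ s ∈ {s : (X → ℂ) × (H →L[ℂ] H) | BddMeas s.1 ∧ Represents μ s.1 s.2},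
        Represents μ (s.1 * f) (s.2 * Q) := by
    intro f hf
    refine Represents.exists_of_continuous hnorm _ (fun s hs => hs.1) ?_ hf
    intro f hf _
    refine ⟨Φ ⟨f, hf⟩, hC ⟨f, hf⟩, ?_⟩
    rintro ⟨g, Q⟩ ⟨hg, hQ⟩
    obtain ⟨R, hR, hRS⟩ := step1 (star g) hg.star
    have h := (hRS _ ⟨star ⟨f, hf⟩, rfl⟩).adjoint
    rw [hR.unique hQ.adjoint] at h
    dsimp only at h ⊢
    convert h using 1
    · ext x
      simp [mul_comm]
    · rw [← ContinuousLinearMap.star_eq_adjoint, ← ContinuousLinearMap.star_eq_adjoint, star_mul,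
        star_star, map_star, star_star]
  -- `op` has to be a total function; its value on other functions is irrelevant.
  have hex : ∀ f : X → ℂ, ∃ Q, BddMeas f → (Represents μ f Q ∧
      ∀ s ∈ {s : (X → ℂ) × (H →L[ℂ] H) | BddMeas s.1 ∧ Represents μ s.1 s.2},
        Represents μ (s.1 * f) (s.2 * Q)) := by
    intro f
    by_cases hf : BddMeas f
    · exact (step2 f hf).imp fun Q hQ _ => hQ
    · exact ⟨0, fun h => absurd h hf⟩
  choose op hop using hex
  refine ⟨μ, op, hfin, fun f => (hop f (hbdd f)).1.unique (hC f), fun f hf => (hop f hf).1,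
    fun f g hf hg => ?_⟩
  exact (hop _ (hf.mul hg)).1.unique ((hop g hg).2 (f, op f) ⟨hf, (hop f hf).1⟩)

end StarAlgHom

/-! ## Spectral measures from functional calculi -/

section Calculus

open scoped InnerProductSpace

variable {H : Type*} [NormedAddCommGroup H] [InnerProductSpace ℂ H]

theorem Represents.inner_self_indicator {X : Type*} [MeasurableSpace X] {μ : H → Measure X}
    {S : Set X} (hS : MeasurableSet S) {Q : H →L[ℂ] H} (hQ : Represents μ (S.indicator 1) Q)
    (v : H) : ⟪v, Q v⟫_ℂ = ((μ v).real S : ℂ) := by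
  rw [hQ v, show S.indicator (1 : X → ℂ) = S.indicator fun _ => 1 from rfl,
    integral_indicator_const 1 hS, Complex.real_smul, mul_one]

variable [CompleteSpace H]

/-- Bounded measurable functional calculi on the real line come from spectral measures. -/
theorem exists_spectralMeasure_of_represents (μ : H → Measure ℝ) [∀ v, IsFiniteMeasure (μ v)]
    (op : (ℝ → ℂ) → H →L[ℂ] H) (hop : ∀ f, BddMeas f → Represents μ f (op f))
    (hmul : ∀ f g, BddMeas f → BddMeas g → op (f * g) = op f * op g) (hone : op 1 = 1) :
    ∃ P : SpectralMeasure H, P.diag = μ := by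
  have hind : ∀ S : Set ℝ, MeasurableSet S → BddMeas (S.indicator (1 : ℝ → ℂ)) :=
    fun S hS => .indicator_one hS
  have hunion : ∀ S T : Set ℝ, MeasurableSet S → MeasurableSet T → Disjoint S T →
      op ((S ∪ T).indicator 1) = op (S.indicator 1) + op (T.indicator 1) := by
    intro S T hS hT hd
    refine (hop _ (hind _ (hS.union hT))).unique ?_
    rw [indicator_union_of_disjoint hd]
    exact (hop _ (hind S hS)).add (hind S hS) (hind T hT) (hop _ (hind T hT))
  have hproj : ∀ S : Set ℝ, MeasurableSet S → IsStarProjection (op (S.indicator 1)) := by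
    intro S hS
    refine ⟨?_, ?_⟩
    · rw [IsIdempotentElem, ← hmul _ _ (hind S hS) (hind S hS), ← Set.inter_indicator_one,
        inter_self]
    · rw [IsSelfAdjoint, ContinuousLinearMap.star_eq_adjoint]
      refine (hop _ (hind S hS)).adjoint.unique ?_
      convert hop _ (hind S hS) using 1
      ext x
      by_cases hx : x ∈ S <;> simp [hx]
  have hnorm : ∀ S : Set ℝ, MeasurableSet S → ∀ v,
      ‖op (S.indicator 1) v‖ ^ 2 = (μ v).real S := by
    intro S hS v
    have h1 := (hop _ (hind S hS)).inner_self_indicator hS v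
    have h2 := hproj S hS
    have h3 : ⟪op (S.indicator 1) v, op (S.indicator 1) v⟫_ℂ = ⟪v, op (S.indicator 1) v⟫_ℂ := by
      rw [← ContinuousLinearMap.adjoint_inner_right, ← ContinuousLinearMap.star_eq_adjoint,
        h2.isSelfAdjoint.star_eq, ← mul_apply_eq_comp, h2.isIdempotentElem.eq]
    rw [h1, inner_self_eq_norm_sq_to_K] at h3
    exact Complex.ofReal_injective (by rw [Complex.ofReal_pow]; exact h3)
  let P : SpectralMeasure H :=
    { proj := fun S => op (S.indicator 1)
      isStarProjection := hproj
      proj_univ := by rw [indicator_univ, hone]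
      proj_inter := fun S T hS hT => by
        rw [← hmul _ _ (hind S hS) (hind T hT), Set.inter_indicator_one]
      hasSum_proj := by
        intro S hS hd v
        have hfin : ∀ s : Finset ℕ, ∑ n ∈ s, op ((S n).indicator 1) =
            op ((⋃ n ∈ s, S n).indicator 1) := by
          intro s
          induction s using Finset.induction_on with
          | empty =>
            simp only [Finset.sum_empty, Finset.notMem_empty, iUnion_of_empty, iUnion_empty]
            refine Represents.unique (μ := μ) (fun v => ?_) (hop _ (hind _ .empty))
            simp
          | insert n s hn ih =>
            rw [Finset.sum_insert hn, ih, Finset.set_biUnion_insert,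
              hunion _ (⋃ i ∈ s, S i) (hS n) (s.measurableSet_biUnion fun i _ => hS i)]
            simp only [disjoint_iUnion_right]
            exact fun i hi => hd (fun h => hn (h ▸ hi))
        have hU : MeasurableSet (⋃ n, S n) := .iUnion hS
        have hsum : HasSum (fun n => (μ v).real (S n)) ((μ v).real (⋃ n, S n)) := by
          have h := ENNReal.hasSum_toReal (f := fun n => μ v (S n))
            (by rw [← measure_iUnion hd hS]; exact measure_ne_top _ _)
          rwa [← ENNReal.tsum_toReal_eq (fun n => measure_ne_top _ _),
            ← measure_iUnion hd hS] at h
        rw [HasSum, tendsto_iff_norm_sub_tendsto_zero]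
        -- The squared norm of the tail is the μ_v-measure of the part of the union not yet covered,
        -- so countable additivity of μ_v yields strong convergence.
        have hsq : Tendsto (fun s : Finset ℕ =>
            ‖∑ n ∈ s, op ((S n).indicator 1) v - op ((⋃ n, S n).indicator 1) v‖ ^ 2) atTop
            (𝓝 0) := by
          have h0 := (tendsto_const_nhds (x := (μ v).real (⋃ n, S n))).sub hsum
          rw [sub_self] at h0
          refine h0.congr fun s => ?_
          have hT : MeasurableSet (⋃ n ∈ s, S n) := .biUnion (to_countable _) fun i _ => hS i
          have hsub : (⋃ n ∈ s, S n) ⊆ ⋃ n, S n := iUnion₂_subset_iUnion _ _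
          have h1 := hunion _ _ hT (hU.diff hT) disjoint_sdiff_right
          rw [union_sdiff_cancel hsub] at h1
          have h2 : ∑ n ∈ s, op ((S n).indicator 1) v = op ((⋃ n ∈ s, S n).indicator 1) v := by
            rw [← hfin, sum_apply]
          rw [h2, h1, add_apply, sub_add_cancel_left, norm_neg, hnorm _ (hU.diff hT),
            measureReal_sdiff hsub hT, measureReal_biUnion_finset (fun i _ j _ hij => hd hij)
              fun i _ => hS i]
        have := hsq.sqrt
        simpa [Real.sqrt_sq] using this }
  refine ⟨P, funext fun v => Measure.ext fun S hS => ?_⟩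
  rw [SpectralMeasure.diag, Measure.ofMeasurable_apply S hS,
    (hop _ (hind S hS)).inner_self_indicator hS v, Complex.ofReal_re, ofReal_measureReal]

/-- `op` is the bounded measurable functional calculus of the spectral measure `P`. -/
structure SpectralMeasure.IsCalculus (P : SpectralMeasure H) (op : (ℝ → ℂ) → H →L[ℂ] H) : Prop where
  represents : ∀ f, BddMeas f → Represents P.diag f (op f)
  map_mul : ∀ f g, BddMeas f → BddMeas g → op (f * g) = op f * op g

end Calculus

/-! ## Resolvents of selfadjoint relations -/

section Relation

open scoped InnerProductSpace

variable {H : Type*} [NormedAddCommGroup H] [InnerProductSpace ℂ H] {G : Submodule ℂ (H × H)}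

theorem Submodule.mem_adjoint_iff_inner_eq {p : H × H} :
    p ∈ G.adjoint ↔ ∀ q ∈ G, ⟪q.2, p.1⟫_ℂ = ⟪q.1, p.2⟫_ℂ := by
  rw [Submodule.mem_adjoint_iff]
  exact ⟨fun h q hq => sub_eq_zero.mp (h q.1 q.2 hq), fun h a b hab => sub_eq_zero.mpr (h _ hab)⟩

theorem Submodule.isClosed_adjoint : IsClosed (G.adjoint : Set (H × H)) := by
  rw [Submodule.adjoint, Submodule.map_coe, LinearEquiv.coe_coe,
    LinearEquiv.image_eq_preimage_symm]
  exact (Submodule.isClosed_orthogonal _).preimage (WithLp.prod_continuous_toLp _ _ _)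

variable [CompleteSpace H]

/-- Orthogonality of (r, s) to G reads ⟪b, s⟫ = ⟪a, -r⟫ for all (a, b) in G. The projection is taken
in the ℓ² product, since the norm of `H × H` is not Hilbertian. -/
theorem Submodule.exists_add_orthogonal (hG : IsClosed (G : Set (H × H))) (p : H × H) :
    ∃ q ∈ G, ∃ r : H × H, p = q + r ∧ (r.2, -r.1) ∈ G.adjoint := by
  let G' : Submodule ℂ (WithLp 2 (H × H)) :=
    G.comap (WithLp.linearEquiv 2 ℂ (H × H)).toLinearMap
  have hG' : IsClosed (G' : Set (WithLp 2 (H × H))) :=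
    hG.preimage (WithLp.prod_continuous_ofLp 2 H H)
  have : CompleteSpace G' := hG'.completeSpace_coe
  obtain ⟨y, hy, z, hz, h⟩ := G'.exists_add_mem_mem_orthogonal (WithLp.toLp 2 p)
  refine ⟨WithLp.ofLp y, hy, WithLp.ofLp z, congrArg WithLp.ofLp h, ?_⟩
  rw [Submodule.mem_adjoint_iff_inner_eq]
  intro q hq
  have := (Submodule.mem_orthogonal _ _).mp hz (WithLp.toLp 2 q) hq
  rw [WithLp.prod_inner_apply] at this
  rw [inner_neg_right]
  exact eq_neg_of_add_eq_zero_right this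

/-- This is R = (A + c)⁻¹ for c = ±i. Surjectivity of A + c comes from splitting (0, y) along G and
its orthogonal complement; injectivity and ‖R‖ ≤ 1 come from the symmetry of A, which makes 2c‖x‖²
equal to ⟪x, (A + c)x⟫ - ⟪(A + c)x, x⟫. -/
theorem exists_resolvent (hG : G.adjoint = G) {c : ℂ} (hc : c * c = -1) (hc' : star c = -c) :
    ∃ R : H →L[ℂ] H, (∀ y, (R y, y - c • R y) ∈ G) ∧ ∀ p ∈ G, R (p.2 + c • p.1) = p.1 := by
  have hex : ∀ y, ∃ x, (x, y - c • x) ∈ G := by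
    intro y
    obtain ⟨⟨a, b⟩, hq, ⟨r, s⟩, hp, hr⟩ :=
      Submodule.exists_add_orthogonal (G := G) (hG ▸ Submodule.isClosed_adjoint) (0, y)
    rw [hG] at hr
    simp only [Prod.mk_add_mk, Prod.mk.injEq] at hp
    obtain ⟨h1, h2⟩ := hp
    have h3 : -r = a := by rw [eq_comm, ← add_eq_zero_iff_eq_neg]; exact h1.symm
    refine ⟨a - c • s, ?_⟩
    convert G.sub_mem hq (G.smul_mem c hr) using 1
    simp only [Prod.smul_mk, Prod.mk_sub_mk, Prod.mk.injEq, true_and, h3, h2, smul_sub, smul_smul,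
      hc]
    module
  have hnorm : ∀ p ∈ G, ‖p.1‖ ≤ ‖p.2 + c • p.1‖ := by
    intro p hp
    have h1 : ⟪p.2, p.1⟫_ℂ = ⟪p.1, p.2⟫_ℂ :=
      Submodule.mem_adjoint_iff_inner_eq.mp (by rwa [hG]) p hp
    have h2 : (‖p.1‖ : ℂ) ^ 2 * (2 * c) =
        ⟪p.1, p.2 + c • p.1⟫_ℂ - ⟪p.2 + c • p.1, p.1⟫_ℂ := by
      rw [inner_add_right, inner_add_left, inner_smul_left, inner_smul_right, h1,
        inner_self_eq_norm_sq_to_K, show (starRingEnd ℂ) c = -c from hc']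
      simp only [Complex.coe_algebraMap]
      ring
    have hcn : ‖c‖ = 1 := by
      have : ‖c‖ * ‖c‖ = 1 := by rw [← norm_mul, hc, norm_neg, norm_one]
      nlinarith [norm_nonneg c]
    have h3 : ‖p.1‖ ^ 2 * 2 ≤ ‖p.1‖ * ‖p.2 + c • p.1‖ + ‖p.2 + c • p.1‖ * ‖p.1‖ := by
      have := congrArg norm h2
      rw [norm_mul, norm_mul, hcn, norm_pow, Complex.norm_real, norm_norm] at this
      calc ‖p.1‖ ^ 2 * 2 = ‖p.1‖ ^ 2 * (‖(2 : ℂ)‖ * 1) := by simp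
        _ = _ := this
        _ ≤ _ := (norm_sub_le _ _).trans
          (add_le_add (norm_inner_le_norm _ _) (norm_inner_le_norm _ _))
    by_contra hlt
    push Not at hlt
    nlinarith [norm_nonneg p.1, norm_nonneg (p.2 + c • p.1)]
  choose f hf using hex
  have huniq : ∀ p ∈ G, f (p.2 + c • p.1) = p.1 := by
    intro p hp
    have h := hnorm _ (G.sub_mem (hf (p.2 + c • p.1)) hp)
    have h0 : p.2 + c • p.1 - c • f (p.2 + c • p.1) - p.2 + c • (f (p.2 + c • p.1) - p.1) = 0 := by
      module
    simp only [Prod.fst_sub, Prod.snd_sub] at h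
    rw [h0, norm_zero] at h
    exact sub_eq_zero.mp (norm_le_zero_iff.mp h)
  refine ⟨LinearMap.mkContinuous ⟨⟨f, fun x y => ?_⟩, fun a x => ?_⟩ 1 fun y => ?_, hf, huniq⟩
  · refine Eq.trans (congrArg f ?_) (huniq _ (G.add_mem (hf x) (hf y)))
    simp only [Prod.mk_add_mk]
    module
  · refine Eq.trans (congrArg f ?_) (huniq _ (G.smul_mem a (hf x)))
    simp only [Prod.smul_mk]
    module
  · rw [one_mul]
    simpa using hnorm _ (hf y)

end Relation

/-! ## The spectral theorem for selfadjoint relations -/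

section SpectralTheorem

open scoped InnerProductSpace

variable {H : Type*} [NormedAddCommGroup H] [InnerProductSpace ℂ H] [CompleteSpace H]
  {G : Submodule ℂ (H × H)}

/-- The function `f` cut off outside of `[-n, n]`. -/
noncomputable def cutoff (n : ℕ) (f : ℝ → ℂ) : ℝ → ℂ := (Icc (-n : ℝ) n).indicator f

theorem BddMeas.cutoff {f : ℝ → ℂ} (hf : Continuous f) (n : ℕ) : BddMeas (cutoff n f) := by
  obtain ⟨C, hC⟩ := (isCompact_Icc (a := (-n : ℝ)) (b := n)).exists_bound_of_continuousOn
    hf.continuousOn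
  refine ⟨hf.measurable.indicator measurableSet_Icc, max C 0, fun x => ?_⟩
  by_cases hx : x ∈ Icc (-n : ℝ) n
  · rw [_root_.cutoff, indicator_of_mem hx]
    exact (hC x hx).trans (le_max_left _ _)
  · rw [_root_.cutoff, indicator_of_notMem hx, norm_zero]
    exact le_max_right _ _

theorem BddMeas.cutoff_one (n : ℕ) : BddMeas (_root_.cutoff n 1) := BddMeas.cutoff continuous_const n

theorem cutoff_mul_cutoff (n : ℕ) (f g : ℝ → ℂ) :
    cutoff n f * cutoff n g = cutoff n (f * g) :=
  (Set.indicator_mul _ f g).symm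

theorem cutoff_mul_left (n : ℕ) (f g : ℝ → ℂ) : cutoff n (f * g) = f * cutoff n g := by
  ext x
  by_cases hx : x ∈ Icc (-n : ℝ) n <;> simp [cutoff, hx]

theorem tendsto_cutoff (f : ℝ → ℂ) (x : ℝ) :
    Tendsto (fun n : ℕ => cutoff n f x) atTop (𝓝 (f x)) := by
  refine tendsto_const_nhds.congr' ?_
  obtain ⟨N, hN⟩ := exists_nat_ge |x|
  filter_upwards [eventually_ge_atTop N] with n hn
  have hn' : (N : ℝ) ≤ n := by exact_mod_cast hn
  rw [cutoff, indicator_of_mem]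
  exact abs_le.mp (hN.trans hn')

namespace SpectralMeasure

theorem diag_apply (P : SpectralMeasure H) (v : H) {S : Set ℝ} (hS : MeasurableSet S) :
    P.diag v S = ENNReal.ofReal (⟪v, P.proj S v⟫_ℂ).re :=
  Measure.ofMeasurable_apply S hS

instance (P : SpectralMeasure H) (v : H) : IsFiniteMeasure (P.diag v) :=
  ⟨by rw [P.diag_apply v .univ]; exact ENNReal.ofReal_lt_top⟩

theorem diag_real_univ (P : SpectralMeasure H) (v : H) : (P.diag v).real univ = ‖v‖ ^ 2 := by
  rw [Measure.real, P.diag_apply v .univ, P.proj_univ, one_apply_eq_self,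
    ENNReal.toReal_ofReal (r := (⟪v, v⟫_ℂ).re) (inner_self_nonneg (𝕜 := ℂ))]
  exact (norm_sq_eq_re_inner (𝕜 := ℂ) v).symm

namespace IsCalculus

variable {P : SpectralMeasure H} {op : (ℝ → ℂ) → H →L[ℂ] H}

theorem map_one (hP : P.IsCalculus op) : op 1 = 1 := by
  refine (hP.represents 1 ⟨measurable_const, 1, by simp⟩).unique fun v => ?_
  rw [one_apply_eq_self, inner_self_eq_norm_sq_to_K]
  have h := P.diag_real_univ v
  simp only [Pi.one_apply, integral_const, Complex.real_smul, mul_one, h, Complex.ofReal_pow]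
  rfl

theorem map_add (hP : P.IsCalculus op) {f g : ℝ → ℂ} (hf : BddMeas f) (hg : BddMeas g) :
    op (f + g) = op f + op g :=
  (hP.represents _ (hf.add hg)).unique
    ((hP.represents f hf).add hf hg (hP.represents g hg))

theorem map_smul (hP : P.IsCalculus op) (c : ℂ) {f : ℝ → ℂ} (hf : BddMeas f) :
    op (c • f) = c • op f :=
  (hP.represents _ (hf.const_smul c)).unique ((hP.represents f hf).const_smul c)

theorem map_sub (hP : P.IsCalculus op) {f g : ℝ → ℂ} (hf : BddMeas f) (hg : BddMeas g) :
    op (f - g) = op f - op g := by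
  have h : f - g = f + (-1 : ℂ) • g := by rw [neg_smul, one_smul, sub_eq_add_neg]
  rw [h, hP.map_add hf (hg.const_smul _), hP.map_smul _ hg, neg_smul, one_smul, sub_eq_add_neg]

theorem adjoint_eq (hP : P.IsCalculus op) {f : ℝ → ℂ} (hf : BddMeas f) :
    ContinuousLinearMap.adjoint (op f) = op (star f) :=
  (hP.represents f hf).adjoint.unique (hP.represents _ hf.star)

theorem inner_apply_right (hP : P.IsCalculus op) {f : ℝ → ℂ} (hf : BddMeas f) (u v : H) :
    ⟪u, op f v⟫_ℂ = ⟪op (star f) u, v⟫_ℂ := by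
  rw [← hP.adjoint_eq hf, ContinuousLinearMap.adjoint_inner_left]

theorem norm_sq_apply (hP : P.IsCalculus op) {f : ℝ → ℂ} (hf : BddMeas f) (v : H) :
    ‖op f v‖ ^ 2 = ∫ s, ‖f s‖ ^ 2 ∂(P.diag v) := by
  apply Complex.ofReal_injective
  rw [← integral_complex_ofReal, Complex.ofReal_pow]
  have h : ⟪op f v, op f v⟫_ℂ = ∫ s, (star f * f) s ∂(P.diag v) := by
    rw [← ContinuousLinearMap.adjoint_inner_right, hP.adjoint_eq hf, ← mul_apply_eq_comp,
      ← hP.map_mul _ _ hf.star hf]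
    exact hP.represents _ (hf.star.mul hf) v
  rw [inner_self_eq_norm_sq_to_K] at h
  refine Eq.trans h (integral_congr_ae (.of_forall fun s => ?_))
  simp only [Pi.mul_apply, Pi.star_apply, RCLike.star_def]
  rw [Complex.conj_mul', Complex.ofReal_pow]

/-- Strong convergence, because ‖op(F n - f) v‖² = ∫ |F n - f|² dP^v tends to 0 by dominated
convergence. -/
theorem tendsto_apply (hP : P.IsCalculus op) {F : ℕ → ℝ → ℂ} {f : ℝ → ℂ} {C : ℝ}
    (hF : ∀ n, Measurable (F n)) (hC : ∀ n s, ‖F n s‖ ≤ C)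
    (hlim : ∀ s, Tendsto (fun n => F n s) atTop (𝓝 (f s))) (v : H) :
    Tendsto (fun n => op (F n) v) atTop (𝓝 (op f v)) := by
  have hfm : Measurable f := measurable_of_tendsto_metrizable hF (tendsto_pi_nhds.mpr hlim)
  have hfC : ∀ s, ‖f s‖ ≤ C := fun s => le_of_tendsto (hlim s).norm (.of_forall fun n => hC n s)
  have hFb : ∀ n, BddMeas (F n) := fun n => ⟨hF n, C, hC n⟩
  have hfb : BddMeas f := ⟨hfm, C, hfC⟩
  have h : Tendsto (fun n => ∫ s, ‖(F n - f) s‖ ^ 2 ∂(P.diag v)) atTop (𝓝 0) := by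
    have h0 : (0 : ℝ) = ∫ _, (0 : ℝ) ∂(P.diag v) := by simp
    rw [h0]
    refine tendsto_integral_of_dominated_convergence (fun _ => (C + C) ^ 2)
      (fun n => (((hF n).sub hfm).norm.pow_const 2).aestronglyMeasurable) (integrable_const _)
      (fun n => .of_forall fun s => ?_) (.of_forall fun s => ?_)
    · rw [Real.norm_of_nonneg (by positivity)]
      exact pow_le_pow_left₀ (norm_nonneg _)
        ((norm_sub_le _ _).trans (add_le_add (hC n s) (hfC s))) 2
    · have := ((hlim s).sub_const (f s)).norm.pow 2
      simpa using this
  rw [tendsto_iff_norm_sub_tendsto_zero]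
  have hsq := h.sqrt
  rw [Real.sqrt_zero] at hsq
  refine hsq.congr fun n => ?_
  have hb : BddMeas (F n - f) := by
    simpa [sub_eq_add_neg] using (hFb n).add (hfb.const_smul (-1))
  rw [← hP.norm_sq_apply hb, Real.sqrt_sq (norm_nonneg _), hP.map_sub (hFb n) hfb, sub_apply]

theorem tendsto_cutoff_one (hP : P.IsCalculus op) (v : H) :
    Tendsto (fun n => op (cutoff n 1) v) atTop (𝓝 v) := by
  have h := hP.tendsto_apply (F := fun n => cutoff n 1) (f := 1) (C := 1)
    (fun n => (BddMeas.cutoff continuous_const n).1)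
    (fun n s => (norm_indicator_le_norm_self _ _).trans (by simp)) (tendsto_cutoff 1) v
  rwa [hP.map_one] at h

end IsCalculus

end SpectralMeasure

/-- The spectral theorem: a selfadjoint relation without multivalued part has a spectral measure,
with a bounded measurable functional calculus compatible with its resolvent. -/
theorem exists_isCalculus_resolvent (hG : G.adjoint = G) (h0 : ∀ y, ((0 : H), y) ∈ G → y = 0)
    {R : H →L[ℂ] H} (hR : ∀ y, (R y, y - Complex.I • R y) ∈ G)
    (hR' : ∀ p ∈ G, R (p.2 + Complex.I • p.1) = p.1) :
    ∃ (P : SpectralMeasure H) (op : (ℝ → ℂ) → H →L[ℂ] H), P.IsCalculus op ∧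
      op (fun s : ℝ => ((s : ℂ) + Complex.I)⁻¹) = R := by
  obtain ⟨T, hT, hT'⟩ := exists_resolvent hG (c := -Complex.I) (by simp) (by simp)
  have hadj : star R = T := by
    rw [ContinuousLinearMap.star_eq_adjoint, eq_comm, ContinuousLinearMap.eq_adjoint_iff]
    intro u v
    have h := Submodule.mem_adjoint_iff_inner_eq.mp (by rw [hG]; exact hR v) _ (hT u)
    simp only [inner_sub_left, inner_sub_right, inner_smul_left, inner_smul_right, map_neg,
      Complex.conj_I] at h
    linear_combination -h
  -- The resolvent identity, in both orders of the factors; comparing the two shows that R commutes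
  -- with R* = T.
  have hRT : R - T = (-2 * Complex.I) • (T * R) := by
    ext u
    have h := hT' _ (hR u)
    have h2 : u - Complex.I • R u + -Complex.I • R u = u - (2 * Complex.I) • R u := by module
    simp only [h2, map_sub, map_smul] at h
    simp only [sub_apply, smul_apply, mul_apply_eq_comp]
    conv_lhs => rw [← h]
    module
  have hTR : R - T = (-2 * Complex.I) • (R * T) := by
    ext u
    have h := hR' _ (hT u)
    have h2 : u - -Complex.I • T u + Complex.I • T u = u + (2 * Complex.I) • T u := by module
    simp only [h2, map_add, map_smul] at h
    simp only [sub_apply, smul_apply, mul_apply_eq_comp]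
    conv_lhs => rw [← h]
    module
  have hnorm : IsStarNormal R := ⟨by
    rw [hadj]
    exact smul_right_injective _ (by simp : (-2 * Complex.I) ≠ 0) (hRT.symm.trans hTR)⟩
  let Φ : C(spectrum ℂ R, ℂ) →⋆ₐ[ℂ] (H →L[ℂ] H) := cfcHom hnorm
  let ι : C(spectrum ℂ R, ℂ) := (ContinuousMap.id ℂ).restrict (spectrum ℂ R)
  have hι : Φ ι = R := cfcHom_id hnorm
  -- The spectrum lies on the image of ℝ ∪ {∞} under s ↦ 1/(s + i): for z ≠ 0 the equation says
  -- Im(1/z) = 1.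
  have hcirc : ∀ z : spectrum ℂ R, (z : ℂ) - star (z : ℂ) = -2 * Complex.I * (star (z : ℂ) * z) := by
    have h : ι - star ι = (-2 * Complex.I) • (star ι * ι) := by
      refine cfcHom_injective hnorm ?_
      change Φ _ = Φ _
      rw [map_sub, map_smul, map_mul, map_star, hι, hadj, hRT]
    intro z
    exact DFunLike.congr_fun h z
  obtain ⟨μ, op, hfin, hΦ, hop, hmul⟩ := StarAlgHom.exists_represents Φ
  -- The inverse of s ↦ 1/(s + i). The point z = 0, which corresponds to s = ∞, is sent to the
  -- arbitrary value 0.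
  let g : spectrum ℂ R → ℝ := fun z => ((z : ℂ)⁻¹).re
  have hg : Measurable g := Complex.measurable_re.comp measurable_subtype_coe.inv
  let Z : Set (spectrum ℂ R) := {z | (z : ℂ) = 0}
  have hm : MeasurableSet Z := measurable_subtype_coe (measurableSet_singleton 0)
  have hι' : BddMeas ι := ⟨ι.continuous.measurable, ‖ι‖, ι.norm_coe_le_norm⟩
  -- The point at infinity carries no mass: TQ = 0 puts (0, Qv) into G, which has no multivalued
  -- part.
  have hzero : op (Z.indicator 1) = 0 := by
    set Q := op (Z.indicator 1)
    have h1 : T * Q = 0 := by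
      have hTs : op (star ι) = T := 
        (hΦ (star ι)).trans ((map_star Φ ι).trans ((congrArg star hι).trans hadj))
      rw [← hTs, ← hmul _ _ hι'.star (.indicator_one hm)]
      have : star (ι : spectrum ℂ R → ℂ) * Z.indicator 1 =
          ((0 : C(spectrum ℂ R, ℂ)) : spectrum ℂ R → ℂ) := by
        ext z
        by_cases hz : (z : ℂ) = 0 <;> simp [ι, Z, hz]
      rw [this, hΦ, map_zero]
    ext v
    have h2 := hT (Q v)
    rw [← mul_apply_eq_comp, h1, zero_apply, smul_zero, sub_zero] at h2
    exact h0 _ h2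
  have hpush : ∀ f, BddMeas f → Represents (fun v => (μ v).map g) f (op (f ∘ g)) := by
    intro f hf v
    rw [hop _ (hf.comp hg) v, integral_map hg.aemeasurable hf.1.aestronglyMeasurable]
    rfl
  have hfin' : ∀ v, IsFiniteMeasure ((μ v).map g) := fun v => inferInstance
  obtain ⟨P, hP⟩ := exists_spectralMeasure_of_represents (fun v => (μ v).map g)
    (fun f => op (f ∘ g)) hpush (fun f h hf hh => hmul _ _ (hf.comp hg) (hh.comp hg))
    ((hΦ 1).trans (map_one Φ))
  refine ⟨P, fun f => op (f ∘ g), ⟨fun f hf => hP ▸ hpush f hf,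
    fun f h hf hh => hmul _ _ (hf.comp hg) (hh.comp hg)⟩, ?_⟩
  -- At z = 0 the left side is 1/i = -i, whence the correction term, which `op` annihilates.
  have hsum : (fun s : ℝ => ((s : ℂ) + Complex.I)⁻¹) ∘ g =
      ι + (-Complex.I) • (Z.indicator 1 : spectrum ℂ R → ℂ) := by
    ext z
    by_cases hz : (z : ℂ) = 0
    · simp [ι, g, Z, hz]
    · have hz' : star (z : ℂ) ≠ 0 := star_ne_zero.mpr hz
      have him : ((z : ℂ)⁻¹).im = 1 := by
        have h1 : (z : ℂ)⁻¹ - star ((z : ℂ)⁻¹) = 2 * Complex.I := by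
          rw [star_inv₀]
          field_simp
          linear_combination -hcirc z
        generalize (z : ℂ)⁻¹ = y at h1
        have h2 := congrArg Complex.im h1
        simp only [Complex.sub_im, RCLike.star_def, Complex.conj_im, Complex.mul_im,
          Complex.I_im, Complex.I_re] at h2
        norm_num at h2
        linarith
      have h3 : ((g z : ℝ) : ℂ) + Complex.I = (z : ℂ)⁻¹ := by
        apply Complex.ext <;> simp [g, him]
      simp [ι, Z, hz, h3]
  dsimp only
  rw [hsum]
  refine Represents.unique (hop _ ?_) ?_
  · exact hι'.add ((BddMeas.indicator_one hm).const_smul _)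
  · have := (hop _ hι').add hι' ((BddMeas.indicator_one hm).const_smul (-Complex.I))
      ((hop _ (.indicator_one hm)).const_smul (-Complex.I))
    rwa [hzero, smul_zero, add_zero, hΦ, hι] at this

/-- The spectral theorem: a selfadjoint relation without multivalued part has a spectral measure
with a bounded measurable functional calculus, and the relation is given by `∫ s dP(s)`. -/
theorem exists_isCalculus (hG : G.adjoint = G) (h0 : ∀ y, ((0 : H), y) ∈ G → y = 0) :
    ∃ (P : SpectralMeasure H) (op : (ℝ → ℂ) → H →L[ℂ] H), P.IsCalculus op ∧
      ∀ p, p ∈ G ↔ ∀ n, op (cutoff n 1) p.2 = op (cutoff n fun s => (s : ℂ)) p.1 := by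
  obtain ⟨R, hR, hR'⟩ := exists_resolvent hG (c := Complex.I) (by simp) (by simp)
  obtain ⟨P, op, hP, hop⟩ := exists_isCalculus_resolvent hG h0 hR hR'
  refine ⟨P, op, hP, ?_⟩
  have hne : ∀ s : ℝ, (s : ℂ) + Complex.I ≠ 0 := fun s h => by
    simpa using congrArg Complex.im h
  have hrb : BddMeas fun s : ℝ => ((s : ℂ) + Complex.I)⁻¹ := by
    refine ⟨(Continuous.inv₀ (by fun_prop) hne).measurable, 1, fun s => ?_⟩
    rw [norm_inv]
    refine inv_le_one_of_one_le₀ ?_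
    simpa using Complex.abs_im_le_norm ((s : ℂ) + Complex.I)
  have h1 : ∀ n, BddMeas (cutoff n 1) := BddMeas.cutoff continuous_const
  have hs : ∀ n, BddMeas (cutoff n fun s => (s : ℂ)) := BddMeas.cutoff Complex.continuous_ofReal
  have hcomm : ∀ n, op (cutoff n 1) * R = R * op (cutoff n 1) := fun n => by
    rw [← hop, ← hP.map_mul _ _ (h1 n) hrb, ← hP.map_mul _ _ hrb (h1 n), mul_comm]
  -- The truncated form of (A + i)R = 1.
  have hid : ∀ n, op (cutoff n fun s => (s : ℂ)) * R + Complex.I • (op (cutoff n 1) * R) =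
      op (cutoff n 1) := fun n => by
    rw [← hop, ← hP.map_mul _ _ (h1 n) hrb, ← hP.map_mul _ _ (hs n) hrb]
    refine ((hP.represents _ ((hs n).mul hrb)).add ((hs n).mul hrb)
      (((h1 n).mul hrb).const_smul Complex.I)
      ((hP.represents _ ((h1 n).mul hrb)).const_smul _)).unique ?_
    convert hP.represents _ (h1 n) using 1
    ext s
    by_cases hs : s ∈ Icc (-n : ℝ) n
    · simp only [cutoff, Pi.add_apply, Pi.mul_apply, Pi.smul_apply, indicator_of_mem hs,
        Pi.one_apply, one_mul, smul_eq_mul]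
      rw [← add_mul, mul_inv_cancel₀ (hne s)]
    · simp [cutoff, hs]
  rintro ⟨v, w⟩
  constructor
  · intro h n
    have hv := hR' _ h
    dsimp only at hv ⊢
    have h2 := DFunLike.congr_fun (hid n) (w + Complex.I • v)
    rw [add_apply, smul_apply, mul_apply_eq_comp, mul_apply_eq_comp, hv, map_add, map_smul] at h2
    exact (add_right_cancel h2).symm
  · intro h
    -- The truncated equations give 1_n R(w + iv) = 1_n v for each n; then n → ∞.
    have hv : R (w + Complex.I • v) = v := by
      refine tendsto_nhds_unique ?_ (hP.tendsto_cutoff_one v)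
      refine (hP.tendsto_cutoff_one _).congr fun n => ?_
      have hcomm' : ∀ v, op (cutoff n fun s => (s : ℂ)) (R v) =
        R (op (cutoff n fun s => (s : ℂ)) v) := fun v => by
        rw [← mul_apply_eq_comp, ← mul_apply_eq_comp, ← hop, ← hP.map_mul _ _ (hs n) hrb,
          ← hP.map_mul _ _ hrb (hs n), mul_comm]
      rw [← mul_apply_eq_comp, hcomm, mul_apply_eq_comp, map_add, map_smul, h n, map_add,
        map_smul, ← hcomm', ← mul_apply_eq_comp R, ← hcomm]
      exact DFunLike.congr_fun (hid n) v
    have := hR (w + Complex.I • v)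
    rwa [hv, add_sub_cancel_right] at this

end SpectralTheorem

/-! ## Unbounded functions of selfadjoint operators via cutoffs -/

section Cutoff

open scoped InnerProductSpace

variable {H : Type*} [NormedAddCommGroup H] [InnerProductSpace ℂ H] [CompleteSpace H]

namespace SpectralMeasure

variable {P : SpectralMeasure H} {f : ℝ → ℝ} {u v : H}

theorem re_inner_proj_eq (P : SpectralMeasure H) {S : Set ℝ} (hS : MeasurableSet S) (v : H) :
    (⟪v, P.proj S v⟫_ℂ).re = ‖P.proj S v‖ ^ 2 := by
  have h := P.isStarProjection S hS
  have h3 : ⟪P.proj S v, P.proj S v⟫_ℂ = ⟪v, P.proj S v⟫_ℂ := by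
    rw [← ContinuousLinearMap.adjoint_inner_right, ← ContinuousLinearMap.star_eq_adjoint,
      h.isSelfAdjoint.star_eq, ← mul_apply_eq_comp, h.isIdempotentElem.eq]
  rw [← h3]
  exact (norm_sq_eq_re_inner (𝕜 := ℂ) _).symm

/-- From ‖a + b‖² ≤ 2(‖a‖² + ‖b‖²); this makes the domain of ∫ f dP stable under addition. -/
theorem diag_add_le (P : SpectralMeasure H) (u v : H) :
    P.diag (u + v) ≤ (2 : ENNReal) • (P.diag u + P.diag v) := by
  refine Measure.le_iff.mpr fun S hS => ?_
  rw [Measure.smul_apply, Measure.add_apply, smul_eq_mul, P.diag_apply _ hS, P.diag_apply _ hS,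
    P.diag_apply _ hS, P.re_inner_proj_eq hS, P.re_inner_proj_eq hS, P.re_inner_proj_eq hS,
    ← ENNReal.ofReal_add (by positivity) (by positivity),
    show (2 : ENNReal) = ENNReal.ofReal 2 by simp, ← ENNReal.ofReal_mul (by norm_num)]
  refine ENNReal.ofReal_le_ofReal ?_
  rw [map_add]
  have h := norm_add_le (P.proj S u) (P.proj S v)
  nlinarith [norm_nonneg (P.proj S u + P.proj S v), sq_nonneg (‖P.proj S u‖ - ‖P.proj S v‖)]

theorem diag_smul (P : SpectralMeasure H) {c : ℂ} (hc : ‖c‖ = 1) (v : H) :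
    P.diag (c • v) = P.diag v := by
  refine Measure.ext fun S hS => ?_
  rw [P.diag_apply _ hS, P.diag_apply _ hS, P.re_inner_proj_eq hS, P.re_inner_proj_eq hS,
    map_smul, norm_smul, hc, one_mul]

theorem add_mem_dom (hu : u ∈ P.dom f) (hv : v ∈ P.dom f) : u + v ∈ P.dom f := by
  refine lt_of_le_of_lt (lintegral_mono' (P.diag_add_le u v) le_rfl) ?_
  rw [lintegral_smul_measure, lintegral_add_measure]
  exact ENNReal.mul_lt_top (by simp) (ENNReal.add_lt_top.mpr ⟨hu, hv⟩)

theorem smul_mem_dom {c : ℂ} (hc : ‖c‖ = 1) (hv : v ∈ P.dom f) : c • v ∈ P.dom f := by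
  rw [dom, mem_ofPred_eq, P.diag_smul hc]
  exact hv

theorem sub_mem_dom (hu : u ∈ P.dom f) (hv : v ∈ P.dom f) : u - v ∈ P.dom f := by
  have h := add_mem_dom hu (smul_mem_dom (c := -1) (by simp) hv)
  rwa [neg_smul, one_smul, ← sub_eq_add_neg] at h

theorem integrable_of_mem_dom (hf : Continuous f) (hv : v ∈ P.dom f) :
    Integrable f (P.diag v) := by
  refine ⟨hf.aestronglyMeasurable, ?_⟩
  rw [hasFiniteIntegral_iff_norm]
  have h : ∀ s, ENNReal.ofReal ‖f s‖ ≤ 1 + ENNReal.ofReal (f s ^ 2) := fun s => by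
    rw [← ENNReal.ofReal_one, ← ENNReal.ofReal_add zero_le_one (sq_nonneg _)]
    refine ENNReal.ofReal_le_ofReal ?_
    rw [Real.norm_eq_abs, ← sq_abs]
    nlinarith [sq_nonneg (|f s| - 1), abs_nonneg (f s)]
  refine lt_of_le_of_lt (lintegral_mono h) ?_
  rw [lintegral_add_left measurable_const, lintegral_const, one_mul]
  exact ENNReal.add_lt_top.mpr ⟨measure_lt_top _ _, hv⟩

namespace IsCalculus

variable {op : (ℝ → ℂ) → H →L[ℂ] H} {g : ℝ → ℂ}

theorem norm_op_le (hP : P.IsCalculus op) {C : ℝ} (hC : 0 ≤ C) (hg : Measurable g)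
    (h : ∀ s, ‖g s‖ ≤ C) : ‖op g‖ ≤ 2 * C :=
  Represents.norm_le (fun v => (P.diag_real_univ v).le) hC h (hP.represents g ⟨hg, C, h⟩)

theorem norm_op_cutoff_one_le (hP : P.IsCalculus op) (n : ℕ) : ‖op (cutoff n 1)‖ ≤ 2 := by
  simpa using hP.norm_op_le (g := cutoff n 1) zero_le_one
    (BddMeas.cutoff_one n).1 fun s => (norm_indicator_le_norm_self _ _).trans (by simp)

theorem op_cutoff_one_mul (hP : P.IsCalculus op) (hg : Continuous g) (m n : ℕ) :
    op (cutoff m 1) * op (cutoff n g) = op (cutoff m g) * op (cutoff n 1) := by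
  rw [← hP.map_mul _ _ (BddMeas.cutoff_one m) (BddMeas.cutoff hg n),
    ← hP.map_mul _ _ (BddMeas.cutoff hg m) (BddMeas.cutoff_one n)]
  congr 1
  ext s
  simp only [cutoff, Pi.mul_apply, indicator_apply]
  split_ifs <;> simp

theorem op_cutoff_comm (hP : P.IsCalculus op) (hg : Continuous g) (m n : ℕ) :
    op (cutoff m 1) * op (cutoff n g) = op (cutoff n g) * op (cutoff m 1) := by
  rw [← hP.map_mul _ _ (BddMeas.cutoff_one m) (BddMeas.cutoff hg n), mul_comm,
    hP.map_mul _ _ (BddMeas.cutoff hg n) (BddMeas.cutoff_one m)]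

theorem inner_op_cutoff_one (hP : P.IsCalculus op) (n : ℕ) (u v : H) :
    ⟪op (cutoff n 1) u, v⟫_ℂ = ⟪u, op (cutoff n 1) v⟫_ℂ := by
  rw [hP.inner_apply_right (BddMeas.cutoff_one n)]
  congr 3
  ext s
  simp only [cutoff, Pi.star_apply, indicator_apply]
  split_ifs <;> simp

/-- Fatou's lemma, applied to ∫ |1_n f|² dP^v = ‖op(1_n f) v‖². -/
theorem mem_dom_of_bound (hP : P.IsCalculus op) (hf : Continuous f) {C : ℝ}
    (hC : ∀ n, ‖op (cutoff n fun s => (f s : ℂ)) v‖ ≤ C) : v ∈ P.dom f := by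
  have hfc : Continuous fun s => (f s : ℂ) := Complex.continuous_ofReal.comp hf
  have hlim : ∀ s, Tendsto (fun n => ENNReal.ofReal (‖cutoff n (fun s => (f s : ℂ)) s‖ ^ 2)) atTop
      (𝓝 (ENNReal.ofReal (f s ^ 2))) := by
    intro s
    refine ENNReal.tendsto_ofReal ?_
    have h := (tendsto_cutoff (fun s => (f s : ℂ)) s).norm.pow 2
    simpa using h
  have hle : ∀ n, ∫⁻ s, ENNReal.ofReal (‖cutoff n (fun s => (f s : ℂ)) s‖ ^ 2) ∂(P.diag v) ≤
      ENNReal.ofReal (C ^ 2) := by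
    intro n
    have hb := BddMeas.cutoff hfc n
    have hint : Integrable (fun s => ‖cutoff n (fun s => (f s : ℂ)) s‖ ^ 2) (P.diag v) := by
      obtain ⟨D, hD⟩ := hb.2
      refine Integrable.of_bound (hb.1.norm.pow_const 2).aestronglyMeasurable (D ^ 2)
        (.of_forall fun s => ?_)
      rw [Real.norm_of_nonneg (by positivity)]
      exact pow_le_pow_left₀ (norm_nonneg _) (hD s) 2
    rw [← ofReal_integral_eq_lintegral_ofReal hint (.of_forall fun s => by positivity),
      ← hP.norm_sq_apply hb]
    exact ENNReal.ofReal_le_ofReal (pow_le_pow_left₀ (norm_nonneg _) (hC n) 2)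
  refine lt_of_le_of_lt ?_ (ENNReal.ofReal_lt_top (r := C ^ 2))
  calc ∫⁻ s, ENNReal.ofReal (f s ^ 2) ∂(P.diag v)
      = ∫⁻ s, liminf (fun n => ENNReal.ofReal (‖cutoff n (fun s => (f s : ℂ)) s‖ ^ 2)) atTop
          ∂(P.diag v) := lintegral_congr fun s => (hlim s).liminf_eq.symm
    _ ≤ liminf (fun n => ∫⁻ s, ENNReal.ofReal (‖cutoff n (fun s => (f s : ℂ)) s‖ ^ 2)
          ∂(P.diag v)) atTop := lintegral_liminf_le fun n =>
            ((BddMeas.cutoff hfc n).1.norm.pow_const 2).ennreal_ofReal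
    _ ≤ ENNReal.ofReal (C ^ 2) := by
      refine liminf_le_of_frequently_le' (.of_forall hle)

/-- On the diagonal, dominated convergence with majorant |f|, integrable because |f| ≤ 1 + f² and
P^v is finite; both sides then polarize in the same way. -/
theorem tendsto_sesqIntegral (hP : P.IsCalculus op) (hf : Continuous f) (hu : u ∈ P.dom f)
    (hv : v ∈ P.dom f) :
    Tendsto (fun n => ⟪u, op (cutoff n fun s => (f s : ℂ)) v⟫_ℂ) atTop
      (𝓝 (P.sesqIntegral f u v)) := by
  have hfc : Continuous fun s => (f s : ℂ) := Complex.continuous_ofReal.comp hf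
  have hself : ∀ x ∈ P.dom f, Tendsto (fun n => ⟪x, op (cutoff n fun s => (f s : ℂ)) x⟫_ℂ) atTop
      (𝓝 ((∫ s, f s ∂(P.diag x) : ℝ) : ℂ)) := by
    intro x hx
    rw [← integral_complex_ofReal]
    simp only [fun n => hP.represents _ (BddMeas.cutoff hfc n) x]
    refine tendsto_integral_of_dominated_convergence (fun s => ‖f s‖)
      (fun n => (BddMeas.cutoff hfc n).1.aestronglyMeasurable)
      (integrable_of_mem_dom hf hx).norm (fun n => .of_forall fun s => ?_)
      (.of_forall fun s => tendsto_cutoff _ s)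
    exact (norm_indicator_le_norm_self _ _).trans (by simp)
  have hI : ‖Complex.I‖ = 1 := Complex.norm_I
  simp only [fun n => inner_polarization (op (cutoff n fun s => (f s : ℂ))) u v]
  exact ((((hself _ (add_mem_dom hu hv)).sub (hself _ (sub_mem_dom hu hv))).sub
    ((hself _ (add_mem_dom hu (smul_mem_dom hI hv))).const_mul _)).add
      ((hself _ (sub_mem_dom hu (smul_mem_dom hI hv))).const_mul _)).div_const _

/-- The operator `∫ f dP` in terms of the bounded operators `∫_{[-n, n]} f dP`. -/
theorem maps_iff (hP : P.IsCalculus op) (hf : Continuous f) (v w : H) :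
    P.Maps f v w ↔ ∀ n, op (cutoff n 1) w = op (cutoff n fun s => (f s : ℂ)) v := by
  have hfc : Continuous fun s => (f s : ℂ) := Complex.continuous_ofReal.comp hf
  constructor
  · rintro ⟨hv, hw⟩ n
    refine ext_inner_left ℂ fun x => ?_
    -- Truncated vectors lie in the domain, since (1_m f)(1_n x) = 1_m (1_n f) x is bounded in m.
    -- They suffice as test vectors for 1_n w.
    have hx : op (cutoff n 1) x ∈ P.dom f := by
      refine hP.mem_dom_of_bound hf (C := 2 * ‖op (cutoff n fun s => (f s : ℂ)) x‖) fun m => ?_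
      rw [← mul_apply_eq_comp, ← hP.op_cutoff_one_mul hfc]
      exact ((op (cutoff m 1)).le_opNorm _).trans
        (mul_le_mul_of_nonneg_right (hP.norm_op_cutoff_one_le m) (norm_nonneg _))
    rw [← hP.inner_op_cutoff_one, hw _ hx]
    refine tendsto_nhds_unique (hP.tendsto_sesqIntegral hf hx hv) ?_
    refine ((innerSL ℂ x).continuous.tendsto _ |>.comp
      (hP.tendsto_cutoff_one (op (cutoff n fun s => (f s : ℂ)) v))).congr fun m => ?_
    simp only [Function.comp_apply, innerSL_apply_apply]
    rw [hP.inner_op_cutoff_one, ← mul_apply_eq_comp, ← mul_apply_eq_comp,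
      hP.op_cutoff_one_mul hfc, hP.op_cutoff_comm hfc]
  · intro h
    have hv : v ∈ P.dom f := hP.mem_dom_of_bound hf (C := 2 * ‖w‖) fun n => by
      rw [← h n]
      exact ((op (cutoff n 1)).le_opNorm _).trans
        (mul_le_mul_of_nonneg_right (hP.norm_op_cutoff_one_le n) (norm_nonneg _))
    refine ⟨hv, fun u hu => ?_⟩
    refine tendsto_nhds_unique ?_ (hP.tendsto_sesqIntegral hf hu hv)
    refine ((innerSL ℂ u).continuous.tendsto _ |>.comp (hP.tendsto_cutoff_one w)).congr fun n => ?_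
    rw [← h n]
    rfl

/-! ### Exponentials -/

/-- The operator `∫_{[-n, n]} e^{zs} dP(s)`. -/
noncomputable def cutoffExp (op : (ℝ → ℂ) → H →L[ℂ] H) (n : ℕ) (z : ℂ) : H →L[ℂ] H :=
  op (cutoff n fun s => Complex.exp (z * s))

theorem continuous_exp_mul (z : ℂ) : Continuous fun s : ℝ => Complex.exp (z * s) := by
  fun_prop

theorem cutoffExp_zero (n : ℕ) : cutoffExp op n 0 = op (cutoff n 1) := by
  simp only [cutoffExp, zero_mul, Complex.exp_zero]
  rfl

theorem cutoffExp_add (hP : P.IsCalculus op) (n : ℕ) (z w : ℂ) :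
    cutoffExp op n (z + w) = cutoffExp op n z * cutoffExp op n w := by
  rw [cutoffExp, cutoffExp, cutoffExp, ← hP.map_mul _ _ (BddMeas.cutoff (continuous_exp_mul z) n)
    (BddMeas.cutoff (continuous_exp_mul w) n), cutoff_mul_cutoff]
  congr 2
  ext s
  rw [Pi.mul_apply, ← Complex.exp_add, add_mul]

/-- The calculus bounds the operator remainder by twice the supremum over [-n, n] of the scalar
remainder, which is quadratic in h. -/
theorem hasDerivAt_cutoffExp (hP : P.IsCalculus op) (n : ℕ) (z : ℂ) :
    HasDerivAt (cutoffExp op n) (cutoffExp op n z * op (cutoff n fun s => (s : ℂ))) z := by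
  rw [hasDerivAt_iff_isLittleO_nhds_zero]
  refine Asymptotics.IsBigO.trans_isLittleO (g := fun h : ℂ => h ^ 2) ?_
    (Asymptotics.isLittleO_pow_id one_lt_two)
  -- For |s| ≤ n: |e^{zs}| ≤ e^{‖z‖n}, and |e^{hs} - 1 - hs| ≤ |hs|² as soon as ‖h‖n ≤ 1.
  refine Asymptotics.IsBigO.of_bound (2 * (Real.exp (‖z‖ * n) * n ^ 2)) ?_
  have hsmall : ∀ᶠ h : ℂ in 𝓝 0, ‖h‖ * n < 1 := by
    have : Tendsto (fun h : ℂ => ‖h‖ * n) (𝓝 0) (𝓝 (‖(0 : ℂ)‖ * n)) :=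
      (continuous_norm.mul continuous_const).tendsto 0
    rw [norm_zero, zero_mul] at this
    exact this.eventually_lt_const one_pos
  filter_upwards [hsmall] with h hh
  have hb := fun z => BddMeas.cutoff (continuous_exp_mul z) n
  have hs : BddMeas (cutoff n fun s => (s : ℂ)) := BddMeas.cutoff Complex.continuous_ofReal n
  have hbm := (hb z).mul hs
  have hb1 : BddMeas ((cutoff n fun s => Complex.exp ((z + h) * s)) -
      cutoff n fun s => Complex.exp (z * s)) := by
    simpa [sub_eq_add_neg] using (hb (z + h)).add ((hb z).const_smul (-1))
  rw [cutoffExp, cutoffExp, ← hP.map_mul _ _ (hb z) hs, ← hP.map_sub (hb _) (hb _),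
    ← hP.map_smul _ hbm, ← hP.map_sub hb1 (hbm.const_smul h), norm_pow, mul_assoc]
  refine hP.norm_op_le (by positivity) (hb1.1.sub (hbm.const_smul h).1) fun s => ?_
  by_cases hsn : s ∈ Icc (-n : ℝ) n
  · have hs' : ‖(s : ℂ)‖ ≤ n := by rw [Complex.norm_real]; exact abs_le.mpr hsn
    simp only [cutoff, Pi.sub_apply, Pi.mul_apply, Pi.smul_apply, indicator_of_mem hsn, smul_eq_mul]
    have hfac : Complex.exp ((z + h) * s) - Complex.exp (z * s) - h * (Complex.exp (z * s) * s) =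
        Complex.exp (z * s) * (Complex.exp (h * s) - 1 - h * s) := by
      rw [add_mul, Complex.exp_add]
      ring
    have hhs : ‖h * s‖ ≤ ‖h‖ * n := by
      rw [norm_mul]
      exact mul_le_mul_of_nonneg_left hs' (norm_nonneg _)
    rw [hfac, norm_mul, mul_assoc]
    refine mul_le_mul ?_ ?_ (norm_nonneg _) (Real.exp_nonneg _)
    · refine (Complex.norm_exp_le_exp_norm _).trans (Real.exp_le_exp.mpr ?_)
      rw [norm_mul]
      exact mul_le_mul_of_nonneg_left hs' (norm_nonneg _)
    · refine (Complex.norm_exp_sub_one_sub_id_le (hhs.trans hh.le)).trans ?_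
      calc ‖h * s‖ ^ 2 ≤ (‖h‖ * n) ^ 2 := pow_le_pow_left₀ (norm_nonneg _) hhs 2
        _ = _ := by ring
  · simp only [cutoff, Pi.sub_apply, Pi.mul_apply, Pi.smul_apply, indicator_of_notMem hsn,
      smul_zero, mul_zero, sub_zero, norm_zero]
    positivity

/-- A solution of `φ' = Aφ` on `[0, ε]` is given by the exponentials of the selfadjoint `A`. -/
theorem cutoff_apply_curve (hP : P.IsCalculus op) {G : Submodule ℂ (H × H)}
    (hG : ∀ p ∈ G, ∀ n, op (cutoff n 1) p.2 = op (cutoff n fun s => (s : ℂ)) p.1)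
    {φ : ℝ → H} {ε : ℝ}
    (hφ : ∀ t ∈ Icc 0 ε, ∃ ψ, (φ t, ψ) ∈ G ∧ HasDerivWithinAt φ ψ (Icc 0 ε) t)
    {t : ℝ} (ht : t ∈ Icc 0 ε) (n : ℕ) :
    op (cutoff n 1) (φ t) = cutoffExp op n t (φ 0) := by
  -- The two terms of the product rule cancel, as 1_n ψ = (1_n s) φ(t) for (φ(t), ψ) in G.
  have hd : ∀ t ∈ Icc 0 ε, HasDerivWithinAt (fun t : ℝ => cutoffExp op n (-t) (φ t)) 0
      (Icc 0 ε) t := by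
    intro t ht
    obtain ⟨ψ, hψ, hd⟩ := hφ t ht
    have h1 : HasDerivAt (fun t : ℝ => -(t : ℂ)) (-1) t := (Complex.ofRealCLM.hasDerivAt).neg
    have h2 := (hP.hasDerivAt_cutoffExp n (-t)).scomp t h1
    have h3 := (ContinuousLinearMap.restrictScalarsL ℂ H H ℝ ℝ).hasFDerivAt.comp_hasDerivAt t h2
    have h4 := h3.hasDerivWithinAt.clm_apply hd
    refine h4.congr_deriv ?_
    have h5 : cutoffExp op n (-t) ψ =
        cutoffExp op n (-t) (op (cutoff n fun s => (s : ℂ)) (φ t)) := by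
      rw [← hG _ hψ n, ← mul_apply_eq_comp, ← cutoffExp_zero (op := op), ← hP.cutoffExp_add, add_zero]
    simp [h5]
  have hconst : cutoffExp op n (-t) (φ t) = op (cutoff n 1) (φ 0) := by
    have h := (convex_Icc 0 ε).norm_image_sub_le_of_norm_hasDerivWithin_le (C := 0) hd
      (fun x _ => norm_zero.le) (left_mem_Icc.mpr (ht.1.trans ht.2)) ht
    rw [zero_mul, norm_le_zero_iff, sub_eq_zero] at h
    simpa [cutoffExp_zero] using h
  have h := congrArg (cutoffExp op n t) hconst
  rw [← mul_apply_eq_comp, ← hP.cutoffExp_add, add_neg_cancel, cutoffExp_zero,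
    ← mul_apply_eq_comp, ← cutoffExp_zero (op := op), ← hP.cutoffExp_add, add_zero] at h
  rw [← cutoffExp_zero (op := op)]
  exact h

end IsCalculus

end SpectralMeasure

end Cutoff

/-! ## Fröhlich's criterion for essential selfadjointness -/

section Strip

open scoped InnerProductSpace

variable {H : Type*} [NormedAddCommGroup H] [InnerProductSpace ℂ H] [CompleteSpace H]

namespace SpectralMeasure.IsCalculus

variable {P : SpectralMeasure H} {op : (ℝ → ℂ) → H →L[ℂ] H}

/-- For 0 ≤ Re z ≤ ε, |e^{zs}| is at most 1 if s ≤ 0 and at most e^{εs} if s ≥ 0. The factor χ will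
be 1_n for boundedness and 1_m - 1_n for convergence. -/
theorem norm_sq_mul_exp_le (hP : P.IsCalculus op) {χ : ℝ → ℂ} {z : ℂ} {ε : ℝ} (hχ : BddMeas χ)
    (hz : BddMeas (χ * fun s : ℝ => Complex.exp (z * s)))
    (hε : BddMeas (χ * fun s : ℝ => Complex.exp (ε * s))) (hz0 : 0 ≤ z.re) (hz1 : z.re ≤ ε)
    (v : H) :
    ‖op (χ * fun s : ℝ => Complex.exp (z * s)) v‖ ^ 2 ≤
      ‖op χ v‖ ^ 2 + ‖op (χ * fun s : ℝ => Complex.exp (ε * s)) v‖ ^ 2 := by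
  have hint : ∀ {f : ℝ → ℂ}, BddMeas f → Integrable (fun s => ‖f s‖ ^ 2) (P.diag v) := by
    intro f hf
    obtain ⟨C, hC⟩ := hf.2
    refine Integrable.of_bound (hf.1.norm.pow_const 2).aestronglyMeasurable (C ^ 2)
      (.of_forall fun s => ?_)
    rw [Real.norm_of_nonneg (by positivity)]
    exact pow_le_pow_left₀ (norm_nonneg _) (hC s) 2
  rw [hP.norm_sq_apply hχ, hP.norm_sq_apply hz, hP.norm_sq_apply hε,
    ← integral_add (hint hχ) (hint hε)]
  refine integral_mono (hint hz) ((hint hχ).add (hint hε)) fun s => ?_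
  simp only [Pi.mul_apply, norm_mul, mul_pow, Complex.norm_exp, Complex.re_mul_ofReal,
    Complex.ofReal_re]
  have h : Real.exp (z.re * s) ^ 2 ≤ 1 + Real.exp (ε * s) ^ 2 := by
    rcases le_total s 0 with hs | hs
    · have : Real.exp (z.re * s) ≤ 1 := Real.exp_le_one_iff.mpr (mul_nonpos_of_nonneg_of_nonpos hz0 hs)
      nlinarith [Real.exp_pos (z.re * s), sq_nonneg (Real.exp (ε * s))]
    · have : Real.exp (z.re * s) ≤ Real.exp (ε * s) :=
        Real.exp_le_exp.mpr (mul_le_mul_of_nonneg_right hz1 hs)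
      nlinarith [Real.exp_pos (z.re * s)]
  nlinarith [sq_nonneg ‖χ s‖]

/-- A solution of `φ' = Aφ` on `[0, ε]`, for `A` selfadjoint, extends to a bounded holomorphic
function on the strip `0 < Re z < ε`. -/
theorem exists_strip_extension (hP : P.IsCalculus op) {G : Submodule ℂ (H × H)}
    (hG : ∀ p ∈ G, ∀ n, op (cutoff n 1) p.2 = op (cutoff n fun s => (s : ℂ)) p.1)
    {φ : ℝ → H} {ε : ℝ} (hε : 0 < ε)
    (hφ : ∀ t ∈ Icc 0 ε, ∃ ψ, (φ t, ψ) ∈ G ∧ HasDerivWithinAt φ ψ (Icc 0 ε) t) :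
    ∃ (Ψ : ℂ → H) (C : ℝ), DifferentiableOn ℂ Ψ {z | z.re ∈ Ioo 0 ε} ∧
      (∀ z : ℂ, z.re ∈ Ioo 0 ε → ‖Ψ z‖ ≤ C) ∧ ∀ x ∈ Ioo 0 ε, Ψ (x : ℂ) = φ x := by
  have hexp : ∀ n z, op (cutoff n 1 * fun s : ℝ => Complex.exp (z * s)) = cutoffExp op n z := by
    intro n z
    rw [cutoffExp, mul_comm, ← cutoff_mul_left, mul_one]
  have hmul : ∀ n z, BddMeas (cutoff n 1 * fun s : ℝ => Complex.exp (z * s)) := by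
    intro n z
    rw [mul_comm, ← cutoff_mul_left, mul_one]
    exact BddMeas.cutoff (continuous_exp_mul z) n
  have hsub : ∀ {f g : ℝ → ℂ}, BddMeas f → BddMeas g → BddMeas (f - g) := fun hf hg => by
    simpa [sub_eq_add_neg] using hf.add (hg.const_smul (-1))
  -- The solution up to time ε is what controls the right edge of the strip.
  have hcurve : ∀ n, cutoffExp op n ε (φ 0) = op (cutoff n 1) (φ ε) := fun n =>
    (hP.cutoff_apply_curve hG hφ (right_mem_Icc.mpr hε.le) n).symm
  have hbound : ∀ n (z : ℂ), z.re ∈ Ioo 0 ε →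
      ‖cutoffExp op n z (φ 0)‖ ≤ 2 * ‖φ 0‖ + 2 * ‖φ ε‖ := by
    intro n z hz
    have h := hP.norm_sq_mul_exp_le (BddMeas.cutoff_one n) (hmul n z) (hmul n ε) hz.1.le hz.2.le
      (φ 0)
    rw [hexp, hexp, hcurve] at h
    have hle : ∀ v, ‖op (cutoff n 1) v‖ ≤ 2 * ‖v‖ := fun v =>
      ((op (cutoff n 1)).le_opNorm v).trans
        (mul_le_mul_of_nonneg_right (hP.norm_op_cutoff_one_le n) (norm_nonneg v))
    refine abs_le_of_sq_le_sq' ?_ (by positivity) |>.2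
    have h1 := pow_le_pow_left₀ (norm_nonneg _) (hle (φ 0)) 2
    have h2 := pow_le_pow_left₀ (norm_nonneg _) (hle (φ ε)) 2
    nlinarith [mul_nonneg (norm_nonneg (φ 0)) (norm_nonneg (φ ε))]
  -- The bound does not depend on z, so the entire functions z ↦ e^{zA}1_n φ(0) converge uniformly
  -- on the strip.
  have hdiff : ∀ m n (z : ℂ), z.re ∈ Ioo 0 ε →
      ‖cutoffExp op m z (φ 0) - cutoffExp op n z (φ 0)‖ ^ 2 ≤
        ‖op (cutoff m 1) (φ 0) - op (cutoff n 1) (φ 0)‖ ^ 2 +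
        ‖op (cutoff m 1) (φ ε) - op (cutoff n 1) (φ ε)‖ ^ 2 := by
    intro m n z hz
    have hb : ∀ z : ℂ, BddMeas ((cutoff m 1 - cutoff n 1) * fun s : ℝ => Complex.exp (z * s)) := by
      intro z
      rw [sub_mul]
      exact hsub (hmul m z) (hmul n z)
    have h := hP.norm_sq_mul_exp_le (hsub (BddMeas.cutoff_one m) (BddMeas.cutoff_one n)) (hb z)
      (hb ε) hz.1.le hz.2.le (φ 0)
    rw [sub_mul, sub_mul, hP.map_sub (hmul _ _) (hmul _ _), hP.map_sub (hmul _ _) (hmul _ _),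
      hP.map_sub (BddMeas.cutoff_one m) (BddMeas.cutoff_one n), hexp, hexp, hexp, hexp, sub_apply,
      sub_apply, sub_apply, hcurve, hcurve] at h
    exact h
  have hcauchy : UniformCauchySeqOn (fun n z => cutoffExp op n z (φ 0)) atTop
      {z : ℂ | z.re ∈ Ioo 0 ε} := by
    rw [Metric.uniformCauchySeqOn_iff]
    intro δ hδ
    obtain ⟨N₁, hN₁⟩ := Metric.cauchySeq_iff.mp (hP.tendsto_cutoff_one (φ 0)).cauchySeq (δ / 2)
      (half_pos hδ)
    obtain ⟨N₂, hN₂⟩ := Metric.cauchySeq_iff.mp (hP.tendsto_cutoff_one (φ ε)).cauchySeq (δ / 2)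
      (half_pos hδ)
    refine ⟨max N₁ N₂, fun m hm n hn z hz => ?_⟩
    have h1 := hN₁ m ((le_max_left _ _).trans hm) n ((le_max_left _ _).trans hn)
    have h2 := hN₂ m ((le_max_right _ _).trans hm) n ((le_max_right _ _).trans hn)
    rw [dist_eq_norm] at h1 h2 ⊢
    have h := hdiff m n z hz
    refine abs_lt_of_sq_lt_sq' ?_ hδ.le |>.2
    have h1' := pow_lt_pow_left₀ h1 (norm_nonneg _) two_ne_zero
    have h2' := pow_lt_pow_left₀ h2 (norm_nonneg _) two_ne_zero
    nlinarith [sq_nonneg δ]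
  have hlim : ∀ z : ℂ, ∃ y, z.re ∈ Ioo 0 ε →
      Tendsto (fun n => cutoffExp op n z (φ 0)) atTop (𝓝 y) := by
    intro z
    by_cases hz : z.re ∈ Ioo 0 ε
    · exact (cauchySeq_tendsto_of_complete (hcauchy.cauchySeq hz)).imp fun y hy _ => hy
    · exact ⟨0, fun h => absurd h hz⟩
  choose Ψ hΨ using hlim
  have hopen : IsOpen {z : ℂ | z.re ∈ Ioo 0 ε} := isOpen_Ioo.preimage Complex.continuous_re
  refine ⟨Ψ, 2 * ‖φ 0‖ + 2 * ‖φ ε‖, ?_, fun z hz => ?_, fun x hx => ?_⟩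
  · have hu : TendstoUniformlyOn (fun n z => cutoffExp op n z (φ 0)) Ψ atTop
        {z : ℂ | z.re ∈ Ioo 0 ε} := hcauchy.tendstoUniformlyOn_of_tendsto fun z hz => hΨ z hz
    refine hu.tendstoLocallyUniformlyOn.differentiableOn (.of_forall fun n z _ => ?_) hopen
    exact ((hP.hasDerivAt_cutoffExp n z).differentiableAt.clm_apply
      (differentiableAt_const _)).differentiableWithinAt
  · exact le_of_tendsto (hΨ z hz).norm (.of_forall fun n => hbound n z hz)
  · have hx' : ((x : ℂ)).re ∈ Ioo 0 ε := by rwa [Complex.ofReal_re]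
    refine tendsto_nhds_unique (hΨ x hx') ((hP.tendsto_cutoff_one (φ x)).congr fun n => ?_)
    exact hP.cutoff_apply_curve hG hφ (Ioo_subset_Icc_self hx) n

end SpectralMeasure.IsCalculus

/-- A bounded holomorphic function on a vertical strip is not a multiple of `e^{dz}` on the real
line, for `d = ± i`. -/
theorem eq_zero_of_strip {ε : ℝ} (hε : 0 < ε) {F : ℂ → ℂ} {C : ℝ} {a d : ℂ} (hd : d * d = -1)
    (hF : DifferentiableOn ℂ F {z | z.re ∈ Ioo 0 ε}) (hC : ∀ z : ℂ, z.re ∈ Ioo 0 ε → ‖F z‖ ≤ C)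
    (hx : ∀ x ∈ Ioo 0 ε, F (x : ℂ) = Complex.exp (d * x) * a) : a = 0 := by
  have hopen : IsOpen {z : ℂ | z.re ∈ Ioo 0 ε} := isOpen_Ioo.preimage Complex.continuous_re
  have hconn : IsPreconnected {z : ℂ | z.re ∈ Ioo 0 ε} :=
    ((convex_Ioo 0 ε).linear_preimage Complex.reLm).isPreconnected
  have hg : Differentiable ℂ fun z => Complex.exp (d * z) * a := by fun_prop
  have hmid : ε / 2 ∈ Ioo 0 ε := ⟨half_pos hε, half_lt_self hε⟩
  have hmid' : ((ε / 2 : ℝ) : ℂ) ∈ {z : ℂ | z.re ∈ Ioo 0 ε} := by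
    simpa only [mem_ofPred_eq, Complex.ofReal_re] using hmid
  -- The identity theorem: equality on a real interval spreads to the whole strip.
  have heq : EqOn F (fun z => Complex.exp (d * z) * a) {z : ℂ | z.re ∈ Ioo 0 ε} := by
    refine AnalyticOnNhd.eqOn_of_preconnected_of_frequently_eq (hF.analyticOnNhd hopen)
      (hg.differentiableOn.analyticOnNhd hopen) hconn hmid' ?_
    have ht : Tendsto (fun x : ℝ => (x : ℂ)) (𝓝[≠] (ε / 2)) (𝓝[≠] ((ε / 2 : ℝ) : ℂ)) := by
      refine tendsto_nhdsWithin_iff.mpr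
        ⟨(Complex.continuous_ofReal.tendsto _).mono_left nhdsWithin_le_nhds, ?_⟩
      filter_upwards [self_mem_nhdsWithin] with x hx h
      exact hx (Complex.ofReal_injective h)
    refine ht.frequently (Eventually.frequently ?_)
    filter_upwards [mem_nhdsWithin_of_mem_nhds (Ioo_mem_nhds hmid.1 hmid.2)] with x hx'
    exact hx x hx'
  have hdd : d * star d = 1 := by
    have : ‖d‖ * ‖d‖ = 1 := by rw [← norm_mul, hd, norm_neg, norm_one]
    rw [RCLike.star_def, Complex.mul_conj, Complex.normSq_eq_norm_sq, pow_two, this,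
      Complex.ofReal_one]
  have hre : d.re = 0 := by
    have h1 : star d = -d := by linear_combination (-d) * hdd + star d * hd
    have := congrArg Complex.re h1
    simp only [RCLike.star_def, Complex.conj_re, Complex.neg_re] at this
    linarith
  -- At z = ε/2 + k d̄, which stays on a vertical line as d is imaginary, Re(dz) = k.
  have hle : ∀ k : ℝ, Real.exp k * ‖a‖ ≤ C := by
    intro k
    have hz : ((ε / 2 : ℝ) + k * star d : ℂ).re ∈ Ioo 0 ε := by
      simpa only [Complex.add_re, Complex.ofReal_re, Complex.re_ofReal_mul, RCLike.star_def,
        Complex.conj_re, hre, mul_zero, add_zero] using hmid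
    have h := hC _ hz
    rw [heq hz, norm_mul, Complex.norm_exp] at h
    have h2 : (d * ((ε / 2 : ℝ) + k * star d)).re = k := by
      have : d * ((ε / 2 : ℝ) + k * star d) = (ε / 2 : ℝ) * d + k := by
        linear_combination (k : ℂ) * hdd
      rw [this, Complex.add_re, Complex.re_ofReal_mul, hre, mul_zero, zero_add, Complex.ofReal_re]
    rwa [h2] at h
  by_contra ha
  have ha' : 0 < ‖a‖ := norm_pos_iff.mpr ha
  have ht : Tendsto (fun k => Real.exp k * ‖a‖) atTop atTop :=
    Real.tendsto_exp_atTop.atTop_mul_const ha'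
  obtain ⟨k, hk⟩ := (ht.eventually_gt_atTop C).exists
  exact absurd (hle k) (not_le.mpr hk)

end Strip

/-! ### A selfadjoint relation on H ⊕ H built from any relation -/

section Froehlich

open scoped InnerProductSpace

variable {H : Type*} [NormedAddCommGroup H] [InnerProductSpace ℂ H]
  {G : Submodule ℂ (H × H)}

/-- The relation `[[0, G**], [G*, 0]]` in the Hilbert space sum of two copies of `H`. -/
noncomputable def Submodule.offDiag (G : Submodule ℂ (H × H)) :
    Submodule ℂ (WithLp 2 (H × H) × WithLp 2 (H × H)) where
  carrier := {p | (p.1.snd, p.2.fst) ∈ G.adjoint.adjoint ∧ (p.1.fst, p.2.snd) ∈ G.adjoint}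
  zero_mem' := ⟨zero_mem G.adjoint.adjoint, zero_mem G.adjoint⟩
  add_mem' hp hq := ⟨add_mem hp.1 hq.1, add_mem hp.2 hq.2⟩
  smul_mem' c _ hp := ⟨G.adjoint.adjoint.smul_mem c hp.1, G.adjoint.smul_mem c hp.2⟩

theorem Submodule.le_adjoint_adjoint : G ≤ G.adjoint.adjoint := by
  intro p hp
  rw [mem_adjoint_iff_inner_eq]
  intro q hq
  rw [mem_adjoint_iff_inner_eq] at hq
  rw [← inner_conj_symm, ← hq p hp, inner_conj_symm]

theorem Submodule.adjoint_anti {G' : Submodule ℂ (H × H)} (h : G ≤ G') :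
    G'.adjoint ≤ G.adjoint := by
  intro p hp
  rw [mem_adjoint_iff_inner_eq] at hp ⊢
  exact fun q hq => hp q (h hq)

/-- The adjoint of [[0, B], [C, 0]] is [[0, C*], [B*, 0]]; here B = G** and C = G*, and G*** = G*.
-/
theorem Submodule.adjoint_offDiag : G.offDiag.adjoint = G.offDiag := by
  have h3 : G.adjoint.adjoint.adjoint = G.adjoint :=
    le_antisymm (adjoint_anti le_adjoint_adjoint) le_adjoint_adjoint
  ext ⟨x, y⟩
  rw [mem_adjoint_iff_inner_eq]
  constructor
  · intro h
    refine ⟨?_, ?_⟩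
    · rw [mem_adjoint_iff_inner_eq]
      rintro ⟨a, b⟩ hab
      have := h (WithLp.toLp 2 (a, 0), WithLp.toLp 2 (0, b))
        ⟨zero_mem G.adjoint.adjoint, hab⟩
      simpa [WithLp.prod_inner_apply] using this
    · rw [← h3, mem_adjoint_iff_inner_eq]
      rintro ⟨a, b⟩ hab
      have := h (WithLp.toLp 2 (0, a), WithLp.toLp 2 (b, 0)) ⟨hab, zero_mem G.adjoint⟩
      simpa [WithLp.prod_inner_apply] using this
  · rintro ⟨h1, h2⟩ ⟨a, b⟩ ⟨h4, h5⟩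
    rw [← h3] at h2
    have e1 := mem_adjoint_iff_inner_eq.mp h1 _ h5
    have e2 := mem_adjoint_iff_inner_eq.mp h2 _ h4
    simp only [WithLp.prod_inner_apply]
    dsimp only at e1 e2
    exact (add_comm _ _).trans (congrArg₂ (· + ·) e1 e2)

end Froehlich

/-! ### Deficiency vectors of symmetric relations -/

section Froehlich

open scoped InnerProductSpace

variable {H : Type*} [NormedAddCommGroup H] [InnerProductSpace ℂ H]
  {G : Submodule ℂ (H × H)}

theorem Submodule.topologicalClosure_le_adjoint (hsym : G ≤ G.adjoint) :
    G.topologicalClosure ≤ G.adjoint :=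
  G.topologicalClosure_minimal hsym isClosed_adjoint

variable [CompleteSpace H]

/-- Deficiency vectors of a symmetric relation are orthogonal to the starting points of solutions
of `φ' = Aφ`. -/
theorem Submodule.inner_deficiency_eq_zero (hsym : G ≤ G.adjoint)
    (hdense : ∀ w, (∀ q ∈ G, ⟪q.1, w⟫_ℂ = 0) → w = 0) {c : ℂ} (hc : c * c = -1) {w : H}
    (hw : (w, c • w) ∈ G.adjoint) {φ : ℝ → H} {ε : ℝ} (hε : 0 < ε)
    (hφ : ∀ t ∈ Icc 0 ε, ∃ ψ, (φ t, ψ) ∈ G ∧ HasDerivWithinAt φ ψ (Icc 0 ε) t) :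
    ⟪w, φ 0⟫_ℂ = 0 := by
  have hle := le_adjoint_adjoint (G := G)
  -- Density of the domain of G excludes a multivalued part, both for G* and for G**.
  have hsingle : ∀ G' : Submodule ℂ (H × H), G ≤ G' → ∀ y, ((0 : H), y) ∈ G'.adjoint → y = 0 := by
    intro G' hG' y hy
    refine hdense y fun q hq => ?_
    have := mem_adjoint_iff_inner_eq.mp hy q (hG' hq)
    dsimp only at this
    rw [← this, inner_zero_right]
  obtain ⟨P, op, hP, hB⟩ := exists_isCalculus (G := G.offDiag) adjoint_offDiag (by
    rintro y ⟨h1, h2⟩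
    have e1 := hsingle _ hsym _ h1
    have e2 := hsingle _ le_rfl _ h2
    exact WithLp.ofLp_injective 2 (Prod.ext e1 e2))
  -- The diagonal embedding. As G lies in both G* and G**, it maps solutions for G to solutions for
  -- the off-diagonal relation.
  let J : H →L[ℝ] WithLp 2 (H × H) :=
    (WithLp.prodContinuousLinearEquiv 2 ℝ H H).symm.toContinuousLinearMap ∘L
      (ContinuousLinearMap.id ℝ H).prod (ContinuousLinearMap.id ℝ H)
  have hJ : ∀ t ∈ Icc 0 ε, ∃ ψ, (J (φ t), ψ) ∈ G.offDiag ∧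
      HasDerivWithinAt (fun t => J (φ t)) ψ (Icc 0 ε) t := by
    intro t ht
    obtain ⟨ψ, hψ, hd⟩ := hφ t ht
    exact ⟨J ψ, ⟨hle hψ, hsym hψ⟩, J.hasFDerivAt.comp_hasDerivWithinAt t hd⟩
  obtain ⟨Ψ, C, hΨd, hΨC, hΨ⟩ := hP.exists_strip_extension (fun p hp => (hB p).mp hp) hε hJ
  have hinner : ∀ v, ⟪(WithLp.toLp 2 (w, 0) : WithLp 2 (H × H)), J v⟫_ℂ = ⟪w, v⟫_ℂ := by
    intro v
    simp [J, WithLp.prod_inner_apply]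
  have hstar : star c * star c = -1 := by rw [← star_mul', hc]; simp
  have hode : ∀ x ∈ Icc 0 ε, ⟪w, φ x⟫_ℂ = Complex.exp (star c * x) * ⟪w, φ 0⟫_ℂ := by
    have hd : ∀ x ∈ Icc 0 ε, HasDerivWithinAt
        (fun x : ℝ => Complex.exp (-star c * x) * ⟪w, φ x⟫_ℂ) 0 (Icc 0 ε) x := by
      intro x hx
      obtain ⟨ψ, hψ, hd⟩ := hφ x hx
      have h1 : HasDerivAt (fun x : ℝ => Complex.exp (-star c * x))
          (Complex.exp (-star c * x) * (-star c)) x := by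
        have := (Complex.ofRealCLM.hasDerivAt (x := x)).const_mul (-star c)
        simpa using this.cexp
      have h2 : HasDerivWithinAt (fun x => ⟪w, φ x⟫_ℂ) ⟪w, ψ⟫_ℂ (Icc 0 ε) x :=
        ((innerSL ℂ w).restrictScalars ℝ).hasFDerivAt.comp_hasDerivWithinAt x hd
      have h3 : ⟪w, ψ⟫_ℂ = star c * ⟪w, φ x⟫_ℂ := by
        have := mem_adjoint_iff_inner_eq.mp hw _ hψ
        dsimp only at this
        rw [← inner_conj_symm, this, inner_conj_symm, inner_smul_left]
        rfl
      refine (h1.hasDerivWithinAt.mul h2).congr_deriv ?_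
      rw [h3]
      ring
    intro x hx
    have h := (convex_Icc 0 ε).norm_image_sub_le_of_norm_hasDerivWithin_le (C := 0) hd
      (fun x _ => norm_zero.le) (left_mem_Icc.mpr hε.le) hx
    rw [zero_mul, norm_le_zero_iff, sub_eq_zero] at h
    simp only [Complex.ofReal_zero, mul_zero, Complex.exp_zero, one_mul] at h
    rw [← h, ← mul_assoc, ← Complex.exp_add, neg_mul, add_neg_cancel, Complex.exp_zero, one_mul]
  refine eq_zero_of_strip hε (F := fun z => ⟪(WithLp.toLp 2 (w, 0) : WithLp 2 (H × H)), Ψ z⟫_ℂ)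
    (C := ‖(WithLp.toLp 2 (w, 0) : WithLp 2 (H × H))‖ * C) hstar
    ((innerSL ℂ _).differentiable.comp_differentiableOn hΨd) (fun z hz => ?_) fun x hx => ?_
  · exact (norm_inner_le_norm _ _).trans
      (mul_le_mul_of_nonneg_left (hΨC z hz) (norm_nonneg _))
  · rw [hΨ x hx, hinner]
    exact hode x (Ioo_subset_Icc_self hx)

/-- Fröhlich's criterion: a symmetric relation is essentially selfadjoint if the starting points of
solutions of `φ' = Aφ` are total. -/
theorem Submodule.topologicalClosure_eq_adjoint_of_curves (hsym : G ≤ G.adjoint) {V : Set H}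
    (hV : ∀ w, (∀ v ∈ V, ⟪v, w⟫_ℂ = 0) → w = 0)
    (hcurve : ∀ v ∈ V, ∃ (ε : ℝ) (φ : ℝ → H), 0 < ε ∧ φ 0 = v ∧
      ∀ t ∈ Icc 0 ε, ∃ ψ, (φ t, ψ) ∈ G ∧ HasDerivWithinAt φ ψ (Icc 0 ε) t) :
    G.topologicalClosure = G.adjoint := by
  have hdense : ∀ w, (∀ q ∈ G, ⟪q.1, w⟫_ℂ = 0) → w = 0 := by
    intro w hw
    refine hV w fun v hv => ?_
    obtain ⟨ε, φ, hε, rfl, hφ⟩ := hcurve v hv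
    obtain ⟨ψ, hψ, -⟩ := hφ 0 (left_mem_Icc.mpr hε.le)
    exact hw _ hψ
  have hdef : ∀ c : ℂ, c * c = -1 → ∀ w, (w, c • w) ∈ G.adjoint → w = 0 := by
    intro c hc w hw
    refine hV w fun v hv => ?_
    obtain ⟨ε, φ, hε, rfl, hφ⟩ := hcurve v hv
    rw [← inner_conj_symm, inner_deficiency_eq_zero hsym hdense hc hw hε hφ, map_zero]
  refine le_antisymm (topologicalClosure_le_adjoint hsym) fun p hp => ?_
  obtain ⟨q, hq, ⟨r, s⟩, rfl, hr⟩ :=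
    exists_add_orthogonal (G := G.topologicalClosure) G.isClosed_topologicalClosure p
  have h1 : (r, s) ∈ G.adjoint := by
    have := G.adjoint.sub_mem hp (topologicalClosure_le_adjoint hsym hq)
    rwa [add_sub_cancel_left] at this
  have h2 : (s, -r) ∈ G.adjoint := adjoint_anti G.le_topologicalClosure hr
  -- With (r, s) and (s, -r) both in G*, the combination (r, s) - c(s, -r) equals (x, cx) for x = r
  -- - cs, so x is a deficiency vector.
  have h3 : ∀ c : ℂ, c * c = -1 → r - c • s = 0 := by
    intro c hc
    refine hdef c hc _ ?_
    convert G.adjoint.sub_mem h1 (G.adjoint.smul_mem c h2) using 1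
    simp only [Prod.smul_mk, Prod.mk_sub_mk, Prod.mk.injEq, true_and, smul_sub, smul_smul, hc]
    module
  have h4 := h3 Complex.I Complex.I_mul_I
  have h5 := h3 (-Complex.I) (by simp)
  have hr0 : r = 0 := by
    have : (2 : ℂ) • r = 0 := by
      calc (2 : ℂ) • r = (r - Complex.I • s) + (r - -Complex.I • s) := by module
        _ = 0 := by rw [h4, h5, add_zero]
    simpa using this
  have hs0 : s = 0 := by
    rw [hr0, zero_sub, neg_eq_zero] at h4
    simpa using h4
  rw [hr0, hs0, ← Prod.zero_eq_mk, add_zero]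
  exact hq

theorem Submodule.adjoint_adjoint_of_topologicalClosure_eq (hsym : G ≤ G.adjoint)
    (h : G.topologicalClosure = G.adjoint) : G.adjoint.adjoint = G.adjoint := by
  exact le_antisymm (adjoint_anti hsym)
    (h.symm.le.trans (G.topologicalClosure_minimal le_adjoint_adjoint isClosed_adjoint))

end Froehlich

/-! ## Differentiability of the kernel vectors -/

section DoubleDifference

/-- The mean value inequality twice: in τ for the first derivative minus τL, then in σ for the
increment in τ. -/
theorem norm_double_difference_le {g g₁ g₁₂ : ℝ → ℝ → ℂ} {L : ℂ} {η s s' : ℝ}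
    (h₁ : ∀ σ ∈ uIcc 0 s, ∀ τ ∈ uIcc 0 s', HasDerivAt (fun σ => g σ τ) (g₁ σ τ) σ)
    (h₁₂ : ∀ σ ∈ uIcc 0 s, ∀ τ ∈ uIcc 0 s', HasDerivAt (fun τ => g₁ σ τ) (g₁₂ σ τ) τ)
    (hη : ∀ σ ∈ uIcc 0 s, ∀ τ ∈ uIcc 0 s', ‖g₁₂ σ τ - L‖ ≤ η) :
    ‖g s s' - g s 0 - g 0 s' + g 0 0 - s * s' * L‖ ≤ η * |s'| * |s| := by
  have hin : ∀ σ ∈ uIcc 0 s, ‖g₁ σ s' - g₁ σ 0 - s' * L‖ ≤ η * |s'| := by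
    intro σ hσ
    have h := (convex_uIcc 0 s').norm_image_sub_le_of_norm_hasDerivWithin_le
      (f := fun τ : ℝ => g₁ σ τ - τ * L) (f' := fun τ => g₁₂ σ τ - L) (C := η)
      (fun τ hτ => by
        have h2 := (Complex.ofRealCLM.hasDerivAt (x := τ)).mul_const L
        have h3 := ((h₁₂ σ hσ τ hτ).sub h2).hasDerivWithinAt (s := uIcc 0 s')
        exact h3.congr_deriv (by simp))
      (fun τ hτ => hη σ hσ τ hτ) left_mem_uIcc right_mem_uIcc
    rw [sub_zero, Real.norm_eq_abs] at h
    refine le_trans (le_of_eq (congrArg _ ?_)) h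
    push_cast
    ring
  have h := (convex_uIcc 0 s).norm_image_sub_le_of_norm_hasDerivWithin_le
    (f := fun σ : ℝ => g σ s' - g σ 0 - σ * (s' * L))
    (f' := fun σ => g₁ σ s' - g₁ σ 0 - s' * L) (C := η * |s'|)
    (fun σ hσ => by
      have h2 := (Complex.ofRealCLM.hasDerivAt (x := σ)).mul_const (s' * L)
      have h3 := (((h₁ σ hσ s' right_mem_uIcc).sub (h₁ σ hσ 0 left_mem_uIcc)).sub
        h2).hasDerivWithinAt (s := uIcc 0 s)
      exact h3.congr_deriv (by simp))
    hin left_mem_uIcc right_mem_uIcc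
  rw [sub_zero, Real.norm_eq_abs] at h
  refine le_trans (le_of_eq (congrArg _ ?_)) h
  push_cast
  ring

variable {E : Type*} [AddCommGroup E] [Module ℝ E]

theorem HasDirDeriv.hasDerivAt {f : E → ℂ} {f' : ℂ} {x v : E} {σ : ℝ}
    (h : HasDirDeriv f f' (x + σ • v) v) : HasDerivAt (fun t : ℝ => f (x + t • v)) f' σ := by
  rw [hasDerivAt_iff_tendsto_slope_zero]
  refine Tendsto.congr (fun t => ?_) h
  rw [add_smul, add_assoc]

variable [TopologicalSpace E] [IsTopologicalAddGroup E] [ContinuousSMul ℝ E]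

/-- L is the mixed second derivative at (x, x) along (v, 0) and (0, v). Joint continuity in point
and directions lets a and b vary independently near v without any norm on E. -/
theorem exists_nhds_double_difference {k : E × E → ℂ} {T : Set E} (hT : IsOpen T)
    (hk : LCSmoothOn k (T ×ˢ T)) {x : E} (hx : x ∈ T) (v : E) :
    ∃ L : ℂ, ∀ η > 0, ∃ N ∈ 𝓝 (0 : E), ∃ W ∈ 𝓝 v, ∀ (s s' : ℝ), ∀ a ∈ W, ∀ b ∈ W, s • a ∈ N →
      s' • b ∈ N →
      ‖k (x + s • a, x + s' • b) - k (x + s • a, x) - k (x, x + s' • b) + k (x, x) - s * s' * L‖ ≤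
        η * |s'| * |s| := by
  obtain ⟨D, hD0, hD, hDc⟩ := hk
  -- The most recent direction stands first: the derivative is taken along (a, 0), then along (0,
  -- b).
  let dir : E × E → Fin 2 → E × E := fun q =>
    Matrix.vecCons (0, q.2) (Matrix.vecCons (q.1, 0) ![])
  have hdir : Continuous dir := by
    refine continuous_pi fun i => ?_
    fin_cases i
    · exact Continuous.prodMk continuous_const continuous_snd
    · exact Continuous.prodMk continuous_fst continuous_const
  refine ⟨D 2 (x, x) (dir (v, v)), fun η hη => ?_⟩
  let θ : (E × E) × (E × E) → (E × E) × (Fin 2 → E × E) := fun q =>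
    ((x + q.1.1, x + q.1.2), dir q.2)
  have hθ : Continuous θ := by
    refine Continuous.prodMk ?_ (hdir.comp continuous_snd)
    fun_prop
  have hopen : IsOpen ((T ×ˢ T) ×ˢ (univ : Set (Fin 2 → E × E))) :=
    (hT.prod hT).prod isOpen_univ
  have hmem : θ ((0, 0), (v, v)) ∈ (T ×ˢ T) ×ˢ (univ : Set (Fin 2 → E × E)) := by
    simpa [θ] using hx
  have hcont : ContinuousAt (fun q => D 2 (θ q).1 (θ q).2) ((0, 0), (v, v)) :=
    ((hDc 2).continuousAt (hopen.mem_nhds hmem)).comp hθ.continuousAt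
  have hev : ∀ᶠ q in 𝓝 (((0 : E), (0 : E)), (v, v)), θ q ∈ (T ×ˢ T) ×ˢ univ ∧
      ‖D 2 (θ q).1 (θ q).2 - D 2 (x, x) (dir (v, v))‖ ≤ η := by
    refine (hθ.continuousAt.eventually (hopen.mem_nhds hmem)).and ?_
    have h := (hcont.sub_const (D 2 (x, x) (dir (v, v)))).norm.eventually_le_const (u := η)
      (by simpa [θ] using hη)
    exact h
  rw [nhds_prod_eq, nhds_prod_eq, nhds_prod_eq] at hev
  obtain ⟨A, hA, B, hB, hAB⟩ := eventually_prod_iff.mp hev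
  obtain ⟨N₁, hN₁, N₁', hN₁', hN⟩ := mem_prod_iff.mp hA
  obtain ⟨W₁, hW₁, W₁', hW₁', hW⟩ := mem_prod_iff.mp hB
  -- A balanced neighbourhood containing s • a contains the whole segment from 0 to it, as the mean
  -- value inequality requires.
  refine ⟨balancedCore ℝ (N₁ ∩ N₁'), balancedCore_mem_nhds_zero (inter_mem hN₁ hN₁'),
    W₁ ∩ W₁', inter_mem hW₁ hW₁', fun s s' a ha b hb hsa hsb => ?_⟩
  have hseg : ∀ (s : ℝ) (a : E), s • a ∈ balancedCore ℝ (N₁ ∩ N₁') →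
      ∀ σ : ℝ, σ ∈ uIcc 0 s → σ • a ∈ N₁ ∩ N₁' := by
    intro s a hsa σ hσ
    refine balancedCore_subset (𝕜 := ℝ) _ ?_
    have hle : |σ| ≤ |s| := by
      have := abs_sub_left_of_mem_uIcc hσ
      simpa using this
    by_cases hs : s = 0
    · rw [hs, abs_zero] at hle
      rw [abs_nonpos_iff.mp hle]
      rwa [hs] at hsa
    · have : σ • a = (σ / s) • s • a := by rw [smul_smul, div_mul_cancel₀ _ hs]
      rw [this]
      refine (balancedCore_balanced _).smul_mem ?_ hsa
      rw [norm_div]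
      exact div_le_one_of_le₀ hle (norm_nonneg _)
  have hkey : ∀ σ ∈ uIcc 0 s, ∀ τ ∈ uIcc 0 s', (x + σ • a, x + τ • b) ∈ T ×ˢ T ∧
      ‖D 2 (x + σ • a, x + τ • b) (dir (a, b)) - D 2 (x, x) (dir (v, v))‖ ≤ η := by
    intro σ hσ τ hτ
    have h := hAB (x := (σ • a, τ • b)) (hN ⟨(hseg s a hsa σ hσ).1, (hseg s' b hsb τ hτ).2⟩)
      (y := (a, b)) (hW ⟨ha.1, hb.2⟩)
    exact ⟨h.1.1, h.2⟩
  have h := norm_double_difference_le (s := s) (s' := s')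
    (g := fun σ τ => D 0 (x + σ • a, x + τ • b) ![])
    (g₁ := fun σ τ => D 1 (x + σ • a, x + τ • b) (Matrix.vecCons (a, 0) ![]))
    (g₁₂ := fun σ τ => D 2 (x + σ • a, x + τ • b) (dir (a, b)))
    (L := D 2 (x, x) (dir (v, v))) (η := η)
    (fun σ hσ τ hτ => by
      have e : ∀ σ : ℝ, (x + σ • a, x + τ • b) = (x, x + τ • b) + σ • (a, (0 : E)) := by simp
      have h := hD 0 _ (hkey σ hσ τ hτ).1 ![] (a, 0)
      simp only [e] at h ⊢
      exact h.hasDerivAt (f := fun y => D 0 y ![]))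
    (fun σ hσ τ hτ => by
      have e : ∀ τ : ℝ, (x + σ • a, x + τ • b) = (x + σ • a, x) + τ • ((0 : E), b) := by simp
      have h := hD 1 _ (hkey σ hσ τ hτ).1 (Matrix.vecCons (a, 0) ![]) (0, b)
      simp only [e] at h ⊢
      exact h.hasDerivAt (f := fun y => D 1 y (Matrix.vecCons (a, 0) ![])))
    (fun σ hσ τ hτ => (hkey σ hσ τ hτ).2)
  have hm : ∀ σ ∈ uIcc 0 s, ∀ τ ∈ uIcc 0 s',
      D 0 (x + σ • a, x + τ • b) ![] = k (x + σ • a, x + τ • b) := fun σ hσ τ hτ =>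
    hD0 _ (hkey σ hσ τ hτ).1 _
  rw [hm _ right_mem_uIcc _ right_mem_uIcc, hm _ right_mem_uIcc _ left_mem_uIcc,
    hm _ left_mem_uIcc _ right_mem_uIcc, hm _ left_mem_uIcc _ left_mem_uIcc] at h
  simpa only [zero_smul, add_zero] using h

end DoubleDifference

/-! ### Convergence of vectors from convergence of inner products -/

section HilbertLimit

open scoped InnerProductSpace

/-- The joint limit includes the diagonal, so all three terms of ‖u_i‖² - 2 Re⟪u_i, u_j⟫ + ‖u_j‖²
converge and their limits cancel: the family is Cauchy. -/
theorem exists_tendsto_of_tendsto_inner {ι H : Type*} [NormedAddCommGroup H]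
    [InnerProductSpace ℂ H] [CompleteSpace H] {l : Filter ι} [l.NeBot] {u : ι → H} {L : ℂ}
    (h : Tendsto (fun p : ι × ι => ⟪u p.1, u p.2⟫_ℂ) (l ×ˢ l) (𝓝 L)) :
    ∃ y, Tendsto u l (𝓝 y) := by
  refine cauchy_map_iff_exists_tendsto.mp (cauchy_map_iff.mpr ⟨inferInstance, ?_⟩)
  rw [tendsto_uniformity_iff_dist_tendsto_zero]
  have hd : Tendsto (fun i => ⟪u i, u i⟫_ℂ) l (𝓝 L) := h.comp tendsto_diag
  have hsum : Tendsto (fun p : ι × ι => (⟪u p.1, u p.1⟫_ℂ).re - 2 * (⟪u p.1, u p.2⟫_ℂ).re +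
      (⟪u p.2, u p.2⟫_ℂ).re) (l ×ˢ l) (𝓝 (L.re - 2 * L.re + L.re)) :=
    (((Complex.continuous_re.tendsto L).comp (hd.comp tendsto_fst)).sub
      (((Complex.continuous_re.tendsto L).comp h).const_mul 2)).add
      ((Complex.continuous_re.tendsto L).comp (hd.comp tendsto_snd))
  have h0 : L.re - 2 * L.re + L.re = 0 := by ring
  rw [h0] at hsum
  have hsq := hsum.sqrt
  rw [Real.sqrt_zero] at hsq
  refine hsq.congr fun p => ?_
  rw [dist_eq_norm, ← Real.sqrt_sq (norm_nonneg (u p.1 - u p.2))]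
  congr 1
  have := norm_sub_sq (𝕜 := ℂ) (u p.1) (u p.2)
  rw [this, norm_sq_eq_re_inner (𝕜 := ℂ) (u p.1), norm_sq_eq_re_inner (𝕜 := ℂ) (u p.2)]
  rfl

end HilbertLimit

/-! ## The Lie derivative on the reproducing kernel space -/

section LieDerivative

open scoped InnerProductSpace

variable {M : Type*} (K : M → M → ℂ) [hPD : Fact (IsPosDefKernel K)]

theorem kerVec_inner (m : M) (f : HK K) : ⟪kerVec K m, f⟫_ℂ = f m := by
  have : Fact (kernelMatrix K).PosSemidef := ⟨hPD.out.posSemidef⟩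
  rw [kerVec, RKHS.kerFun_inner]
  simp

theorem kerVec_inner_kerVec (m n : M) : ⟪kerVec K m, kerVec K n⟫_ℂ = K m n := by
  rw [kerVec_inner, kerVec_apply]

theorem eq_zero_of_forall_kerVec_inner {K : M → M → ℂ} [Fact (IsPosDefKernel K)] {f : HK K}
    (h : ∀ m, ⟪kerVec K m, f⟫_ℂ = 0) : f = 0 := by
  refine RKHS.ext fun m => ?_
  rw [← kerVec_inner, h, RKHS.coe_zero]
  rfl

theorem dense_HK0 : Dense (HK0 K : Set (HK K)) := by
  rw [Submodule.dense_iff_topologicalClosure_eq_top, Submodule.topologicalClosure_eq_top_iff,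
    Submodule.eq_bot_iff]
  intro f hf
  exact eq_zero_of_forall_kerVec_inner fun m =>
    (Submodule.mem_orthogonal _ _).mp hf _ (Submodule.subset_span (mem_range_self m))

variable {E : Type*} [AddCommGroup E] [Module ℝ E] [TopologicalSpace E]
  [TopologicalSpace M] [ChartedSpace E M]

/-- `y` is the derivative of `m ↦ K_m` at `m`, in the preferred chart and in the direction `v`,
along all curves in `M` with tangent vector `v` at `m`. -/
def HasKerVecDeriv (m : M) (v : E) (y : HK K) : Prop :=
  Tendsto (fun p : ℝ × E => p.1⁻¹ • (kerVec K ((chartAt E m).symm (chartAt E m m + p.1 • p.2)) -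
    kerVec K m)) (𝓝[≠] 0 ×ˢ 𝓝 v) (𝓝 y)

variable {K}

/-- Since ⟪K_a, K_b⟫ = K(a, b), inner products of the difference quotients are double difference
quotients of K, all close to one number L. -/
theorem exists_hasKerVecDeriv [IsTopologicalAddGroup E] [ContinuousSMul ℝ E]
    (hK : IsSmoothKernel E K) (m : M) (v : E) : ∃ y, HasKerVecDeriv K m v y := by
  set e := chartAt E m
  have hx : e m ∈ e.target := mem_chart_target E m
  have hm : e.symm (e m) = m := e.left_inv (mem_chart_source E m)
  obtain ⟨L, hL⟩ := exists_nhds_double_difference e.open_target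
    (hK e (chart_mem_atlas E m) e (chart_mem_atlas E m)) hx v
  refine exists_tendsto_of_tendsto_inner (L := L) ?_
  rw [Metric.tendsto_nhds]
  intro η hη
  obtain ⟨N, hN, W, hW, h⟩ := hL (η / 2) (half_pos hη)
  have hev : ∀ᶠ p : ℝ × E in 𝓝[≠] 0 ×ˢ 𝓝 v, p.1 ≠ 0 ∧ p.2 ∈ W ∧ p.1 • p.2 ∈ N := by
    refine (tendsto_fst.eventually self_mem_nhdsWithin).and
      ((tendsto_snd.eventually hW).and ?_)
    have ht : Tendsto (fun p : ℝ × E => p.1 • p.2) (𝓝[≠] 0 ×ˢ 𝓝 v) (𝓝 ((0 : ℝ) • v)) :=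
      (tendsto_fst.mono_right nhdsWithin_le_nhds).smul tendsto_snd
    rw [zero_smul] at ht
    exact ht hN
  filter_upwards [(tendsto_fst.eventually hev).and (tendsto_snd.eventually hev)] with
    ⟨⟨s, a⟩, ⟨s', b⟩⟩ ⟨⟨hs, ha, hsa⟩, ⟨hs', hb, hsb⟩⟩
  dsimp only at hs ha hsa hs' hb hsb ⊢
  have key := h s s' a ha b hb hsa hsb
  simp only [hm] at key
  rw [dist_eq_norm]
  have hsc : (s : ℂ) ≠ 0 := by exact_mod_cast hs
  have hsc' : (s' : ℂ) ≠ 0 := by exact_mod_cast hs'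
  have hexp : ⟪s⁻¹ • (kerVec K (e.symm (e m + s • a)) - kerVec K m),
      s'⁻¹ • (kerVec K (e.symm (e m + s' • b)) - kerVec K m)⟫_ℂ - L =
      ((s : ℂ) * s')⁻¹ * (K (e.symm (e m + s • a)) (e.symm (e m + s' • b)) -
        K (e.symm (e m + s • a)) m - K m (e.symm (e m + s' • b)) + K m m - s * s' * L) := by
    rw [← Complex.coe_smul, ← Complex.coe_smul, inner_smul_left, inner_smul_right]
    rw [Complex.conj_ofReal]
    simp only [inner_sub_left, inner_sub_right, kerVec_inner_kerVec, Complex.ofReal_inv]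
    field_simp
    ring
  rw [hexp, norm_mul, norm_inv, norm_mul, Complex.norm_real, Complex.norm_real,
    Real.norm_eq_abs, Real.norm_eq_abs]
  have hpos : 0 < |s| * |s'| := mul_pos (abs_pos.mpr hs) (abs_pos.mpr hs')
  rw [inv_mul_lt_iff₀ hpos]
  refine lt_of_le_of_lt key ?_
  nlinarith

theorem HasKerVecDeriv.hasDirDeriv {m : M} {v : E} {y : HK K} (h : HasKerVecDeriv K m v y)
    (f : HK K) : HasDirDeriv (f ∘ (chartAt E m).symm) ⟪y, f⟫_ℂ (chartAt E m m) v := by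
  have ht : Tendsto (fun t : ℝ => (t, v)) (𝓝[≠] 0) (𝓝[≠] 0 ×ˢ 𝓝 v) :=
    tendsto_id.prodMk tendsto_const_nhds
  have h2 : Tendsto (fun t : ℝ => ⟪t⁻¹ • (kerVec K ((chartAt E m).symm (chartAt E m m + t • v)) -
      kerVec K m), f⟫_ℂ) (𝓝[≠] 0) (𝓝 ⟪y, f⟫_ℂ) := (h.comp ht).inner tendsto_const_nhds
  refine h2.congr fun t => ?_
  rw [← Complex.coe_smul, inner_smul_left, inner_sub_left, kerVec_inner, kerVec_inner,
    Complex.conj_ofReal, Function.comp_apply, Function.comp_apply,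
    (chartAt E m).left_inv (mem_chart_source E m), Complex.real_smul]

/-- In the chart, γ(s) is the base point plus (s - t) times a direction that only converges to
X(γ(t)); hence the moving direction in `HasKerVecDeriv`. -/
theorem HasKerVecDeriv.hasDerivWithinAt [IsTopologicalAddGroup E] [ContinuousSMul ℝ E]
    {X : LCVectorField E M} {γ : ℝ → M} {ε t : ℝ} (hγ : X.IsIntegralCurve γ ε)
    (ht : t ∈ Icc 0 ε) {y : HK K} (h : HasKerVecDeriv K (γ t) (X.valueAt (γ t)) y) :
    HasDerivWithinAt (fun s => kerVec K (γ s)) y (Icc 0 ε) t := by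
  set e := chartAt E (γ t)
  rw [hasDerivWithinAt_iff_tendsto_slope]
  have hsub : Tendsto (fun s => s - t) (𝓝[Icc 0 ε \ {t}] t) (𝓝[≠] 0) := by
    refine tendsto_nhdsWithin_iff.mpr ⟨?_, ?_⟩
    · have : Tendsto (fun s => s - t) (𝓝 t) (𝓝 (t - t)) := tendsto_id.sub_const t
      rw [sub_self] at this
      exact this.mono_left nhdsWithin_le_nhds
    · filter_upwards [self_mem_nhdsWithin] with s hs
      exact sub_ne_zero.mpr hs.2
  refine (h.comp (hsub.prodMk (hγ.2 t ht))).congr' ?_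
  have hsource : ∀ᶠ s in 𝓝[Icc 0 ε \ {t}] t, γ s ∈ e.source :=
    ((hγ.1 t ht).mono_left (nhdsWithin_mono t sdiff_subset)).eventually
      (e.open_source.mem_nhds (mem_chart_source E (γ t)))
  filter_upwards [hsource, self_mem_nhdsWithin] with s hs hs'
  have hne : s - t ≠ 0 := sub_ne_zero.mpr hs'.2
  rw [Function.comp_apply, slope_def_module]
  dsimp only
  rw [smul_inv_smul₀ hne, add_sub_cancel, e.left_inv hs]

/-- L_X at m is the bounded functional ⟪Y m, ·⟫ on H_K. This exhibits the maximal operator as the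
adjoint of the relation spanned by the pairs (K_m, Y_m). -/
theorem mem_lieGraph_iff {X : LCVectorField E M} {Y : M → HK K}
    (hY : ∀ m, HasKerVecDeriv K m (X.valueAt m) (Y m)) {p : HK K × HK K} :
    p ∈ lieGraph K X ↔ ∀ m, ⟪kerVec K m, p.2⟫_ℂ = ⟪Y m, p.1⟫_ℂ := by
  refine forall_congr' fun m => ?_
  rw [kerVec_inner]
  exact ⟨fun h => h.unique ((hY m).hasDirDeriv p.1), fun h => h ▸ (hY m).hasDirDeriv p.1⟩

/-- Y_m(n) = ⟪K_n, Y_m⟫ is the derivative of K in its second argument at (n, m); K-symmetry turns it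
into the derivative of K_m at n. -/
theorem mk_kerVec_mem_lieGraph {X : LCVectorField E M} (hX : X.IsKernelSymmetric K) {Y : M → HK K}
    (hY : ∀ m, HasKerVecDeriv K m (X.valueAt m) (Y m)) (m : M) :
    (kerVec K m, Y m) ∈ lieGraph K X := by
  intro n
  obtain ⟨a, h1, h2⟩ := hX n m
  -- Differentiating K_n gives the first argument of K; Hermitian symmetry and a conjugation
  -- transfer this to the second.
  have h3 : HasDirDeriv ((fun y => star (K n y)) ∘ (chartAt E m).symm) ⟪Y m, kerVec K n⟫_ℂ
      (chartAt E m m) (X.valueAt m) := by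
    have h := (hY m).hasDirDeriv (kerVec K n)
    convert h using 1
    ext x
    simp only [Function.comp_apply]
    rw [kerVec_apply, hPD.out.conj_symm]
  have h4 : HasDirDeriv ((fun y => K n y) ∘ (chartAt E m).symm) ⟪kerVec K n, Y m⟫_ℂ
      (chartAt E m m) (X.valueAt m) := by
    rw [← inner_conj_symm]
    refine ((Complex.continuous_conj.tendsto _).comp h3).congr fun t => ?_
    simp
  have h5 : (Y m) n = a := by
    rw [← kerVec_inner]
    exact h4.unique h2
  have h6 : ((kerVec K m : HK K) : M → ℂ) = fun x => K x m := funext fun x => kerVec_apply K m x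
  change X.HasLieDerivAt (kerVec K m : HK K) ((Y m) n) n
  rw [h5, h6]
  exact h1

end LieDerivative

/-! ### Exponentials along integral curves, and the main theorem -/

section Main

open scoped InnerProductSpace

theorem Submodule.mem_adjoint_span_iff {H : Type*} [NormedAddCommGroup H] [InnerProductSpace ℂ H]
    {S : Set (H × H)} {p : H × H} :
    p ∈ (Submodule.span ℂ S).adjoint ↔ ∀ q ∈ S, ⟪q.2, p.1⟫_ℂ = ⟪q.1, p.2⟫_ℂ := by
  rw [mem_adjoint_iff_inner_eq]
  refine ⟨fun h q hq => h q (subset_span hq), fun h q hq => ?_⟩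
  induction hq using Submodule.span_induction with
  | mem q hq => exact h q hq
  | zero => simp
  | add q r _ _ hq hr => simp only [Prod.fst_add, Prod.snd_add, inner_add_left, hq, hr]
  | smul c q _ hq => simp only [Prod.smul_fst, Prod.smul_snd, inner_smul_left, hq]

/-- A selfadjoint operator has a spectral measure, and its exponentials describe the solutions of
`φ' = Aφ`. -/
theorem LinearPMap.expMaps_of_curve {H : Type*} [NormedAddCommGroup H] [InnerProductSpace ℂ H]
    [CompleteSpace H] {A : H →ₗ.[ℂ] H} (hA : A.graph.adjoint = A.graph) {φ : ℝ → H} {ε : ℝ}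
    (hφ : ∀ t ∈ Icc 0 ε, ∃ ψ, (φ t, ψ) ∈ A.graph ∧ HasDerivWithinAt φ ψ (Icc 0 ε) t) {t : ℝ}
    (ht : t ∈ Icc 0 ε) : ExpMaps A t (φ 0) (φ t) := by
  obtain ⟨P, op, hP, hB⟩ := exists_isCalculus hA fun y hy => A.graph_fst_eq_zero_snd hy rfl
  refine ⟨P, fun v w => ?_, ?_⟩
  · rw [hB, hP.maps_iff continuous_id']
  · rw [hP.maps_iff (by fun_prop)]
    intro n
    rw [hP.cutoff_apply_curve (fun p hp => (hB p).mp hp) hφ ht n,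
      SpectralMeasure.IsCalculus.cutoffExp]
    push_cast
    rfl

theorem theoremT
    {E : Type*} [AddCommGroup E] [Module ℝ E] [TopologicalSpace E] [IsTopologicalAddGroup E]
    [ContinuousSMul ℝ E] [LocallyConvexSpace ℝ E] [T2Space E]
    {M : Type*} [TopologicalSpace M] [T2Space M] [ChartedSpace E M] [IsLCManifold E M]
    (K : M → M → ℂ) [Fact (IsPosDefKernel K)] (hK : IsSmoothKernel E K)
    (X : LCVectorField E M) (hX : X.IsKernelSymmetric K)
    (hγ : ∀ m : M, ∃ (ε : ℝ) (γ : ℝ → M), 0 < ε ∧ γ 0 = m ∧ X.IsIntegralCurve γ ε) :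
    HK0 K ≤ (lieOp K X).domain ∧
    IsEssentiallySelfAdjoint ((lieOp K X).domRestrict (HK0 K)) ∧
    ((lieOp K X).domRestrict (HK0 K)).closure = lieOp K X ∧
    ∀ (m : M) (ε : ℝ) (γ : ℝ → M), 0 < ε → γ 0 = m → X.IsIntegralCurve γ ε →
      ∀ t ∈ Set.Icc 0 ε, ExpMaps (lieOp K X) t (kerVec K m) (kerVec K (γ t)) := by
  choose Y hY using fun m => exists_hasKerVecDeriv hK m (X.valueAt m)
  have hmem := mk_kerVec_mem_lieGraph hX hY
  let G : Submodule ℂ (HK K × HK K) := Submodule.span ℂ (range fun m => (kerVec K m, Y m))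
  have hGadj : G.adjoint = lieGraph K X := by
    ext p
    rw [mem_lieGraph_iff hY, Submodule.mem_adjoint_span_iff, forall_mem_range]
    exact forall_congr' fun m => eq_comm
  have hsym : G ≤ G.adjoint := by
    rw [hGadj]
    exact Submodule.span_le.mpr (range_subset_iff.mpr hmem)
  have hcurve : ∀ (ε : ℝ) (γ : ℝ → M), X.IsIntegralCurve γ ε → ∀ t ∈ Icc 0 ε,
      ∃ ψ, (kerVec K (γ t), ψ) ∈ G ∧
        HasDerivWithinAt (fun t => kerVec K (γ t)) ψ (Icc 0 ε) t := fun ε γ hγ t ht =>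
    ⟨Y (γ t), Submodule.subset_span (mem_range_self _), (hY (γ t)).hasDerivWithinAt hγ ht⟩
  have hclosure : G.topologicalClosure = G.adjoint := by
    refine Submodule.topologicalClosure_eq_adjoint_of_curves hsym (V := range (kerVec K))
      (fun w hw => eq_zero_of_forall_kerVec_inner fun m => hw _ (mem_range_self m)) ?_
    rintro _ ⟨m, rfl⟩
    obtain ⟨ε, γ, hε, h0, hc⟩ := hγ m
    exact ⟨ε, fun t => kerVec K (γ t), hε, congrArg _ h0, hcurve ε γ hc⟩
  have hself := Submodule.adjoint_adjoint_of_topologicalClosure_eq hsym hclosure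
  have hgraph : (lieOp K X).graph = lieGraph K X := mem_lieGraph_lieOp K X
  have hdom : HK0 K ≤ (lieOp K X).domain := by
    refine Submodule.span_le.mpr (range_subset_iff.mpr fun m => ?_)
    exact LinearPMap.mem_domain_of_mem_graph (hgraph ▸ hmem m)
  let A := (lieOp K X).domRestrict (HK0 K)
  have hAle : A ≤ lieOp K X := LinearPMap.domRestrict_le
  have hAdom : HK0 K ≤ A.domain := fun x hx => ⟨hx, hdom hx⟩
  -- A point of the graph of A has its first component in the span of the K_m, so some pair in G
  -- shares it; single-valuedness of L_X^K identifies the second components.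
  have hAgraph : A.graph = G := by
    refine le_antisymm ?_ (Submodule.span_le.mpr (range_subset_iff.mpr fun m => ?_))
    · rintro ⟨φ, ψ⟩ h
      have hφ : φ ∈ G.map (LinearMap.fst ℂ (HK K) (HK K)) := by
        rw [Submodule.map_span, ← range_comp]
        exact (LinearPMap.mem_domain_of_mem_graph h).1
      obtain ⟨⟨φ', ψ'⟩, h', rfl⟩ := hφ
      have hψ : ψ = ψ' := (lieOp K X).mem_graph_snd_inj (LinearPMap.le_graph_of_le hAle h)
        (by rw [hgraph, ← hGadj]; exact hsym h') rfl
      rw [hψ]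
      exact h'
    · have hm : kerVec K m ∈ A.domain := hAdom (Submodule.subset_span (mem_range_self m))
      refine (LinearPMap.mem_graph_iff _).mpr ⟨⟨_, hm⟩, rfl, ?_⟩
      exact (lieOp K X).mem_graph_snd_inj
        (LinearPMap.le_graph_of_le hAle (A.mem_graph ⟨_, hm⟩)) (hgraph ▸ hmem m) rfl
  have hclosed : (lieOp K X).IsClosed := by
    rw [LinearPMap.IsClosed, hgraph, ← hGadj]
    exact Submodule.isClosed_adjoint
  have hclosable : A.IsClosable := hclosed.isClosable.leIsClosable hAle
  -- On graphs: the closure of G is G*, which is the graph of the maximal operator.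
  have hAclosure : A.closure = lieOp K X := by
    apply LinearPMap.eq_of_eq_graph
    rw [← hclosable.graph_closure_eq_closure_graph, hAgraph, hclosure, hGadj, hgraph]
  have hlieself : (lieOp K X).graph.adjoint = (lieOp K X).graph := by
    rw [hgraph, ← hGadj, hself]
  refine ⟨hdom, ⟨(dense_HK0 K).mono hAdom, ?_, ?_⟩, hAclosure, ?_⟩
  · intro x y
    have hy := hsym (hAgraph ▸ A.mem_graph y)
    exact Submodule.mem_adjoint_iff_inner_eq.mp hy _ (hAgraph ▸ A.mem_graph x)
  · rw [hAclosure, LinearPMap.isSelfAdjoint_def]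
    apply LinearPMap.eq_of_eq_graph
    rw [LinearPMap.adjoint_graph_eq_graph_adjoint ((dense_HK0 K).mono hdom), hlieself]
  · rintro m ε γ hε rfl hc t ht
    refine LinearPMap.expMaps_of_curve (φ := fun t => kerVec K (γ t)) hlieself
      (fun t ht => ?_) ht
    obtain ⟨ψ, hψ, hd⟩ := hcurve ε γ hc t ht
    exact ⟨ψ, by rw [hgraph, ← hGadj]; exact hsym hψ, hd⟩

end Main
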